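/- Let $n\ge 0$, let $\lambda=(\lambda_1\ge\dots\ge\lambda_n\ge 0)$ and $\mu=(\mu_1\ge\dots\ge\mu_n\ge0)$ be partitions with at most $n$ parts, and let $r=(r_1,\dots,r_n)$, $s=(s_1,\dots,s_n)$ be sequences of positive integers. Let $x_k,\alpha_k,\beta_k$ ($k\ge1$) be formal variables. **Marked reverse plane partitions.** For partitions $\nu\subseteq\kappa$ with transposes $\nu',\kappa'$, the skew shape $\kappa/\nu$ is the set of cells $(i,j)$ (row $i\ge1$, column $j\ge1$) with $\nu_i<j\le\kappa_i$. A marked reverse plane partition (marked RPP) of shape $\kappa/\nu$ is a filling $T$ of the cells of $\kappa/\nu$ with positive integers, weakly increasing along rows and down columns, in which each entry $T(i,j)$ such that $(i,j+1)\in\kappa/\nu$ and $T(i,j)=T(i,j+1)$ may be marked or not. Its weight $\mathrm{wt}(T)$ is the product over all cells $(i,j)\in\kappa/\nu$ of $$\begin{cases}-\alpha_j & \text{if } T(i,j)\text{ is marked},\\ \beta_{i-1} & \text{if } T(i,j) \text{ is not marked, } (i-1,j)\in\kappa/\nu \text{ and } T(i,j)=T(i-1,j),\\ x_{T(i,j)}&\text{otherwise,}\end{cases}$$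 where the entries are compared as integers, ignoring marks. Let $$g^{\mathrm{row}(r,s)}_{\kappa/\nu}=\sum_T \mathrm{wt}(T),\qquad\text{resp.}\qquad g^{\mathrm{col}(r,s)}_{\kappa/\nu}=\sum_T \mathrm{wt}(T),$$ where $T$ runs over the marked RPPs of shape $\kappa/\nu$ with $r_i\le T(i,j)\le s_i$ for all cells $(i,j)$ (resp. with $r_j\le T(i,j)\le s_j$ for all cells $(i,j)$); here $\kappa$ has at most $n$ rows (resp. at most $n$ columns). If $\nu\not\subseteq\kappa$, both are $0$. **Plethystic notation.** For a finite formal sum $Z=\sum_v c_v v$ of variables $v$ with integer coefficients $c_v$, define $h_m[Z]$ and $e_m[Z]$ by $$\sum_{m\ge0}h_m[Z]\,t^m=\prod_v(1-vt)^{-c_v},\qquad \sum_{m\ge0}e_m[Z]\,t^m=\prod_v(1+vt)^{c_v},$$ and $h_m[Z]=e_m[Z]=0$ for $m<0$. Put $X_{[a,b]}=x_a+x_{a+1}+\dots+x_b$ (which is $0$ if $a>b$), $A_k=\alpha_1+\dots+\alpha_k$ and $B_k=\beta_1+\dots+\beta_k$ (which are $0$ if $k\le0$). **Theorem.** Suppose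 that for every $1\le i\le n-1$ with $\mu_i<\lambda_{i+1}$ we have $r_i\le r_{i+1}$ and $s_i\le s_{i+1}$. Then $$g^{\mathrm{row}(r,s)}_{\lambda/\mu}=\det\Big(h_{\lambda_i-\mu_j-i+j}\big[X_{[r_j,s_i]}-A_{\lambda_i-1}+A_{\mu_j}+B_{i-1}-B_{j-1}\big]\Big)_{i,j=1}^n$$ and $$g^{\mathrm{col}(r,s)}_{\lambda'/\mu'}=\det\Big(e_{\lambda_i-\mu_j-i+j}\big[X_{[r_j,s_i]}-A_{i-1}+A_{j-1}+B_{\lambda_i-1}-B_{\mu_j}\big]\Big)_{i,j=1}^n .$$ -/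

import Mathlib

namespace RefinedDual

/-! ### Variables and plethystic substitution -/

/-- The formal variables `x_k`, `α_k`, `β_k`. Only indices `k ≥ 1` are ever used. -/
inductive Var : Type
  | x (k : ℕ)
  | α (k : ℕ)
  | β (k : ℕ)

/-- The ring of polynomials with integer coefficients in the variables `x_k`, `α_k`, `β_k`. -/
abbrev Poly : Type := MvPolynomial Var ℤ

/-- Formal finite sums `∑ c_v v` of variables `v` with integer coefficients; these are the
expressions `Z` that are substituted into `h_m` and `e_m`. -/
abbrev Alphabet : Type := Var →₀ ℤ

/-- The geometric series `∑ vⁿ tⁿ = 1 / (1 - v t)`. -/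
noncomputable def hUnit (v : Var) : (PowerSeries Poly)ˣ where
  val := PowerSeries.mk fun n => MvPolynomial.X v ^ n
  inv := 1 - PowerSeries.C (MvPolynomial.X v) * PowerSeries.X
  val_inv := by
    ext n
    cases n with
    | zero => simp [mul_sub]
    | succ n => simp [mul_sub, ← mul_assoc, PowerSeries.coeff_succ_mul_X, PowerSeries.coeff_one,
        pow_succ]
  inv_val := by
    rw [mul_comm]
    ext n
    cases n with
    | zero => simp [mul_sub]
    | succ n => simp [mul_sub, ← mul_assoc, PowerSeries.coeff_succ_mul_X, PowerSeries.coeff_one,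
        pow_succ]

/-- The polynomial `1 + v t`, with inverse `∑ (-v)ⁿ tⁿ`. -/
noncomputable def eUnit (v : Var) : (PowerSeries Poly)ˣ where
  val := 1 + PowerSeries.C (MvPolynomial.X v) * PowerSeries.X
  inv := PowerSeries.mk fun n => (-MvPolynomial.X v) ^ n
  val_inv := by
    rw [mul_comm]
    ext n
    cases n with
    | zero => simp [mul_add]
    | succ n => simp [mul_add, ← mul_assoc, PowerSeries.coeff_succ_mul_X, PowerSeries.coeff_one,
        pow_succ]
  inv_val := by
    ext n
    cases n with
    | zero => simp [mul_add]
    | succ n => simp [mul_add, ← mul_assoc, PowerSeries.coeff_succ_mul_X, PowerSeries.coeff_one,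
        pow_succ]

/-- The generating function `∑ₘ h_m[Z] tᵐ = ∏ᵥ (1 - v t) ^ (-c_v)` for `Z = ∑ c_v v`. -/
noncomputable def hSeries (Z : Alphabet) : (PowerSeries Poly)ˣ :=
  Z.prod fun v c => hUnit v ^ c

/-- The generating function `∑ₘ e_m[Z] tᵐ = ∏ᵥ (1 + v t) ^ c_v` for `Z = ∑ c_v v`. -/
noncomputable def eSeries (Z : Alphabet) : (PowerSeries Poly)ˣ :=
  Z.prod fun v c => eUnit v ^ c

/-- The plethystic substitution `h_m[Z]`, which is `0` for `m < 0`. -/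
noncomputable def h (m : ℤ) (Z : Alphabet) : Poly :=
  if 0 ≤ m then PowerSeries.coeff m.toNat (hSeries Z : PowerSeries Poly) else 0

/-- The plethystic substitution `e_m[Z]`, which is `0` for `m < 0`. -/
noncomputable def e (m : ℤ) (Z : Alphabet) : Poly :=
  if 0 ≤ m then PowerSeries.coeff m.toNat (eSeries Z : PowerSeries Poly) else 0

/-! The rules that characterize plethystic substitution into `h_m` and `e_m`: the values at a
single variable, `h_n[Y + Z] = ∑_{a+b=n} h_a[Y] h_b[Z]` (likewise for `e`), and
`h_n[-Z] = (-1)ⁿ e_n[Z]`. -/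

theorem h_nat (n : ℕ) (Z : Alphabet) :
    h n Z = PowerSeries.coeff n (hSeries Z : PowerSeries Poly) := by
  simp [h]

theorem e_nat (n : ℕ) (Z : Alphabet) :
    e n Z = PowerSeries.coeff n (eSeries Z : PowerSeries Poly) := by
  simp [e]

theorem h_single (n : ℕ) (v : Var) : h n (Finsupp.single v 1) = MvPolynomial.X v ^ n := by
  simp [h, hSeries, hUnit]

theorem e_single (n : ℕ) (v : Var) :
    e n (Finsupp.single v 1) = if n = 0 then 1 else if n = 1 then MvPolynomial.X v else 0 := by
  rw [e_nat]
  rcases n with _ | _ | n <;>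
    simp [eSeries, eUnit, PowerSeries.coeff_succ_mul_X, PowerSeries.coeff_one,
      PowerSeries.coeff_C]

theorem hSeries_add (Y Z : Alphabet) : hSeries (Y + Z) = hSeries Y * hSeries Z :=
  Finsupp.prod_add_index' (fun _ => zpow_zero _) fun _ _ _ => zpow_add _ _ _

theorem eSeries_add (Y Z : Alphabet) : eSeries (Y + Z) = eSeries Y * eSeries Z :=
  Finsupp.prod_add_index' (fun _ => zpow_zero _) fun _ _ _ => zpow_add _ _ _

theorem h_add (n : ℕ) (Y Z : Alphabet) :
    h n (Y + Z) = ∑ p ∈ Finset.HasAntidiagonal.antidiagonal n, h p.1 Y * h p.2 Z := by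
  simp [h, hSeries_add, PowerSeries.coeff_mul]

theorem e_add (n : ℕ) (Y Z : Alphabet) :
    e n (Y + Z) = ∑ p ∈ Finset.HasAntidiagonal.antidiagonal n, e p.1 Y * e p.2 Z := by
  simp [e, eSeries_add, PowerSeries.coeff_mul]

theorem h_neg (n : ℕ) (Z : Alphabet) : h n (-Z) = (-1) ^ n * e n Z := by
  have key : ∀ Z : Alphabet, hSeries (-Z) =
      Units.map (PowerSeries.rescale (-1 : Poly) : PowerSeries Poly →* PowerSeries Poly)
        (eSeries Z) := by
    intro Z
    rw [hSeries, Finsupp.prod_neg_index (fun _ => zpow_zero _), eSeries, Finsupp.prod,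
      Finsupp.prod, map_prod]
    refine Finset.prod_congr rfl fun v _ => ?_
    rw [map_zpow, zpow_neg, ← inv_zpow]
    congr 1
    ext : 1
    have hC : PowerSeries.rescale (-1 : Poly) (PowerSeries.C (MvPolynomial.X v)) =
        PowerSeries.C (MvPolynomial.X v) := by
      ext n : 1
      rcases n with _ | n <;> simp [PowerSeries.coeff_rescale, PowerSeries.coeff_C]
    simp [hUnit, eUnit, sub_eq_add_neg, hC]
  simp [h, e, key, PowerSeries.coeff_rescale]

/-- `X_{[r,s]} = x_r + x_{r+1} + ⋯ + x_s`, which is `0` if `r > s`. -/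
noncomputable def Xint (r s : ℕ) : Alphabet :=
  ∑ k ∈ Finset.Icc r s, Finsupp.single (Var.x k) 1

/-- `A_n = α_1 + ⋯ + α_n`. As `A_n = 0` for all `n ≤ 0`, the truncated subtraction `A (n - 1)`
denotes `A_{n-1}` for every `n ≥ 0`. -/
noncomputable def A (n : ℕ) : Alphabet :=
  ∑ k ∈ Finset.Icc 1 n, Finsupp.single (Var.α k) 1

/-- `B_n = β_1 + ⋯ + β_n`. As `B_n = 0` for all `n ≤ 0`, the truncated subtraction `B (n - 1)`
denotes `B_{n-1}` for every `n ≥ 0`. -/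
noncomputable def B (n : ℕ) : Alphabet :=
  ∑ k ∈ Finset.Icc 1 n, Finsupp.single (Var.β k) 1

/-! ### Marked reverse plane partitions -/

/-- The cells of the skew shape `λ/μ`. Rows and columns are numbered from `0`, as everywhere in
`YoungDiagram`: the pair `(i, j)` stands for the cell in row `i + 1` and column `j + 1`. -/
def skew (lam mu : YoungDiagram) : Finset (ℕ × ℕ) := lam.cells \ mu.cells

/-- Marked reverse plane partitions of shape `λ/μ`. There are none unless `μ ⊆ λ`. The entries
outside the shape are set to `0`, so that a filling of the shape is counted once. -/
@[ext]
structure MRPP (lam mu : YoungDiagram) where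
  /-- the underlying integer in each cell -/
  entry : ℕ → ℕ → ℕ
  /-- the set of marked cells -/
  marked : Finset (ℕ × ℕ)
  subset : mu ≤ lam
  pos : ∀ i j, (i, j) ∈ skew lam mu → 0 < entry i j
  zeros : ∀ i j, (i, j) ∉ skew lam mu → entry i j = 0
  row_weak : ∀ i j j', j ≤ j' → (i, j) ∈ skew lam mu → (i, j') ∈ skew lam mu →
    entry i j ≤ entry i j'
  col_weak : ∀ i i' j, i ≤ i' → (i, j) ∈ skew lam mu → (i', j) ∈ skew lam mu →
    entry i j ≤ entry i' j
  marked_spec : ∀ i j, (i, j) ∈ marked → (i, j) ∈ skew lam mu ∧ (i, j + 1) ∈ skew lam mu ∧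
    entry i j = entry i (j + 1)

namespace MRPP

variable {lam mu : YoungDiagram}

open Classical in
/-- The weight of a cell: `-α_{j+1}` if it is marked; `β_i` if it is not marked and has the same
entry as the cell above it (which has to exist); `x_{T(i,j)}` otherwise. -/
noncomputable def cellWt (T : MRPP lam mu) (i j : ℕ) : Poly :=
  if (i, j) ∈ T.marked then -MvPolynomial.X (Var.α (j + 1))
  else if 1 ≤ i ∧ (i - 1, j) ∈ skew lam mu ∧ T.entry i j = T.entry (i - 1) j then
    MvPolynomial.X (Var.β i)
  else MvPolynomial.X (Var.x (T.entry i j))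

/-- The weight of a marked reverse plane partition. -/
noncomputable def wt (T : MRPP lam mu) : Poly := ∏ c ∈ skew lam mu, T.cellWt c.1 c.2

end MRPP

/-- The row-flagged marked reverse plane partitions: `r_i ≤ T(i,j) ≤ s_i`. -/
def rowMRPP (lam mu : YoungDiagram) {n : ℕ} (r s : Fin n → ℕ) : Set (MRPP lam mu) :=
  {T | ∀ (i : Fin n) (j : ℕ), (i.val, j) ∈ skew lam mu →
    r i ≤ T.entry i j ∧ T.entry i j ≤ s i}

/-- The column-flagged marked reverse plane partitions: `r_j ≤ T(i,j) ≤ s_j`. -/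
def colMRPP (lam mu : YoungDiagram) {n : ℕ} (r s : Fin n → ℕ) : Set (MRPP lam mu) :=
  {T | ∀ (i : ℕ) (j : Fin n), (i, j.val) ∈ skew lam mu →
    r j ≤ T.entry i j ∧ T.entry i j ≤ s j}

theorem finite_of_bounded (lam mu : YoungDiagram) (N : ℕ) :
    {T : MRPP lam mu | ∀ i j, T.entry i j ≤ N}.Finite := by
  classical
  let F : MRPP lam mu → (skew lam mu → ℕ) × Finset (ℕ × ℕ) :=
    fun T => (fun c => T.entry c.1.1 c.1.2, T.marked)
  have hF : Function.Injective F := by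
    intro T T' hTT
    have h1 := congrArg Prod.fst hTT
    have h2 := congrArg Prod.snd hTT
    refine MRPP.ext ?_ h2
    funext i j
    by_cases hc : (i, j) ∈ skew lam mu
    · exact congrFun h1 ⟨(i, j), hc⟩
    · rw [T.zeros i j hc, T'.zeros i j hc]
  have hfin : (Set.Iic ((fun _ => N : skew lam mu → ℕ), skew lam mu)).Finite := Set.finite_Iic _
  refine (hfin.preimage (f := F) hF.injOn).subset ?_
  intro T hT
  refine ⟨fun c => hT _ _, fun c hc => ?_⟩
  exact (T.marked_spec c.1 c.2 hc).1

/-- There are finitely many row-flagged marked reverse plane partitions if `λ` has at most `n`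
rows, so that their generating function is a finite sum. -/
theorem rowMRPP_finite (lam mu : YoungDiagram) {n : ℕ} (r s : Fin n → ℕ)
    (hl : lam.colLen 0 ≤ n) : (rowMRPP lam mu r s).Finite := by
  refine (finite_of_bounded lam mu (∑ i, s i)).subset fun T hT i j => ?_
  by_cases hc : (i, j) ∈ skew lam mu
  · have hm : (i, j) ∈ lam := by
      simpa using (Finset.mem_sdiff.1 hc).1
    have hi : i < n := (YoungDiagram.mem_iff_lt_colLen.1
      (lam.up_left_mem le_rfl (Nat.zero_le j) hm)).trans_le hl
    exact (hT ⟨i, hi⟩ j hc).2.trans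
      (Finset.single_le_sum (fun _ _ => Nat.zero_le _) (Finset.mem_univ (⟨i, hi⟩ : Fin n)))
  · rw [T.zeros i j hc]
    exact Nat.zero_le _

/-- There are finitely many column-flagged marked reverse plane partitions if `λ` has at most `n`
columns, so that their generating function is a finite sum. -/
theorem colMRPP_finite (lam mu : YoungDiagram) {n : ℕ} (r s : Fin n → ℕ)
    (hl : lam.rowLen 0 ≤ n) : (colMRPP lam mu r s).Finite := by
  refine (finite_of_bounded lam mu (∑ i, s i)).subset fun T hT i j => ?_
  by_cases hc : (i, j) ∈ skew lam mu
  · have hm : (i, j) ∈ lam := by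
      simpa using (Finset.mem_sdiff.1 hc).1
    have hj : j < n := (YoungDiagram.mem_iff_lt_rowLen.1
      (lam.up_left_mem (Nat.zero_le i) le_rfl hm)).trans_le hl
    exact (hT i ⟨j, hj⟩ hc).2.trans
      (Finset.single_le_sum (fun _ _ => Nat.zero_le _) (Finset.mem_univ (⟨j, hj⟩ : Fin n)))
  · rw [T.zeros i j hc]
    exact Nat.zero_le _

/-- The row-flagged refined dual canonical stable Grothendieck polynomial of shape `λ/μ`. -/
noncomputable def gRow (lam mu : YoungDiagram) {n : ℕ} (r s : Fin n → ℕ) : Poly :=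
  ∑ᶠ T ∈ rowMRPP lam mu r s, T.wt

/-- The column-flagged refined dual canonical stable Grothendieck polynomial of shape `λ/μ`. -/
noncomputable def gCol (lam mu : YoungDiagram) {n : ℕ} (r s : Fin n → ℕ) : Poly :=
  ∑ᶠ T ∈ colMRPP lam mu r s, T.wt

end RefinedDual

open RefinedDual

/-! Both formulas are instances of one identity. Summing over the marks turns the weight of a
reverse plane partition into a product over cells of (`β` or a letter variable) + (`-α` or a second
letter variable). The first summand depends on whether the entry equals the one above, the second on
whether it equals the one to the right. Let each letter `k` carry a bosonic variable `p k` and a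
fermionic variable `y k`, with generating function `(1 + y_k t) / (1 - p_k t)`. The row version is
the case `y = 0`. The column version is the case `p = 0` for the reflected shape with negated
entries, where `α` and `β` exchange roles up to sign.

The common identity `genFun_eq_jtDet` is proved by removing the smallest letter `k`. The cells
filled with `k` form a shape `ν/μ`. Since `ν` is decreasing, a `k`-cell of row `j` in column `c`
lies below another `k` exactly when `μ_{j-1} < c`. So the weight of the strip is a product of
factors `rowWeight`, the `j`-th of which depends only on `ν_j`. This is the recursion
`genFun_remove_letter`.

The determinant obeys the same recursion (`jtDet_remove_letter`). As a determinant is alternating,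
the sum over decreasing `ν` may be extended to independent `ν_j` (`sum_antitone_det`): the terms
with `ν_j > b = ν_{j-1}` add up to a multiple of column `j - 1` at `b`. Each column sum then
telescopes to the column of the original matrix plus a multiple of its predecessor, which does not
affect the determinant.

Flags are comparable only for consecutive rows that share a column. The shape is therefore cut into
blocks of such rows. The matrix is block triangular, and its entries outside the diagonal blocks can
be replaced by zero (`det_eq_det_mask`). -/

namespace FlaggedFilling

/-! ### Determinants -/

section Determinants

variable {R : Type*} [CommRing R] {n : ℕ}

/-- A permutation that does not preserve `b` must raise `b` somewhere, because the sum of all values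
is unchanged. Its term therefore contains a zero entry of `M`, and also a masked entry. -/
theorem det_eq_det_mask (M : Matrix (Fin n) (Fin n) R) (b : Fin n → ℕ)
    (hM : ∀ i j, b j < b i → M i j = 0) :
    M.det = (Matrix.of fun i j => if b i = b j then M i j else 0).det := by
  rw [Matrix.det_apply, Matrix.det_apply]
  refine Finset.sum_congr rfl fun σ _ => ?_
  congr 1
  by_cases hσ : ∀ i, b (σ i) = b i
  · exact Finset.prod_congr rfl fun i _ => by simp [hσ i]
  · have hlt : ∃ i, b i < b (σ i) := by
      by_contra! hle
      refine hσ fun i => ?_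
      have hsum : ∑ i, b (σ i) = ∑ i, b i := Equiv.sum_comp σ b
      exact (Finset.sum_eq_sum_iff_of_le fun i _ => hle i).1 hsum i (Finset.mem_univ i)
    push Not at hσ
    obtain ⟨i, hi⟩ := hσ
    obtain ⟨j, hj⟩ := hlt
    have e1 : ∏ i, M (σ i) i = 0 := Finset.prod_eq_zero (Finset.mem_univ j) (hM _ _ hj)
    have e2 : ∏ i, (Matrix.of fun i j => if b i = b j then M i j else 0) (σ i) i = 0 :=
      Finset.prod_eq_zero (Finset.mem_univ i) (by rw [Matrix.of_apply, if_neg hi])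
    exact e1.trans e2.symm

/-- The sum is grouped by all coordinates other than `j`; overwriting coordinate `j` by `0` labels
the groups. -/
theorem sum_piFinset_filter_eq_zero {ι : Type*} [Fintype ι] [DecidableEq ι] {M : Type*}
    [AddCommMonoid M] (t : ι → Finset ℤ) (j : ι) (Q : (ι → ℤ) → Prop) [DecidablePred Q]
    (f : (ι → ℤ) → M)
    (hf : ∀ ν ∈ Fintype.piFinset t,
      ∑ c ∈ t j with Q (Function.update ν j c), f (Function.update ν j c) = 0) :
    ∑ ν ∈ Fintype.piFinset t with Q ν, f ν = 0 := by
  classical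
  rw [Finset.sum_filter, ← Finset.sum_image' (g := fun ν => Function.update ν j 0)
    (f := fun _ => (0 : M)) (fun ν => if Q ν then f ν else 0) ?_, Finset.sum_const_zero]
  intro ν hν
  refine (hf ν hν).symm.trans ?_
  rw [Finset.sum_filter]
  refine Finset.sum_bij' (fun c _ => Function.update ν j c) (fun ν' _ => ν' j) ?_ ?_ ?_ ?_ ?_
  · intro c hc
    rw [Finset.mem_filter, Fintype.mem_piFinset]
    refine ⟨fun i => ?_, by simp⟩
    rcases eq_or_ne i j with rfl | hij
    · simpa using hc
    · simpa [hij] using Fintype.mem_piFinset.1 hν i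
  · intro ν' hν'
    exact Fintype.mem_piFinset.1 (Finset.mem_filter.1 hν').1 j
  · intro c _
    simp
  · intro ν' hν'
    have h1 := (Finset.mem_filter.1 hν').2
    ext i
    rcases eq_or_ne i j with rfl | hij
    · simp
    · simpa [hij] using (congrFun h1 i).symm
  · intro c _
    rfl

/-- The rows of `M` arise from those of `N` by a unitriangular operation. The correction uses the
predecessor in `N`, not in `M`. -/
theorem det_eq_of_pred {M N : Matrix (Fin n) (Fin n) R}
    (h0 : ∀ j : Fin n, j.val = 0 → M j = N j)
    (h1 : ∀ i j : Fin n, i.val + 1 = j.val → ∃ κ : R, M j = N j + κ • N i) :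
    M.det = N.det := by
  cases n with
  | zero => simp
  | succ n =>
    choose κ hκ using fun i : Fin n => h1 i.castSucc i.succ (by simp)
    refine (Matrix.det_eq_of_forall_row_eq_smul_add_pred (fun i => -κ i) ?_ ?_).symm
    · intro j
      rw [h0 0 rfl]
    · intro i j
      rw [hκ i]
      simp

/-- Summing an alternating family over all decreasing `ν` is the same as summing it over
all `ν`, if the sum over the `ν_j` above `ν_{j-1}` is a multiple of the vector of index `j - 1`. -/
theorem sum_antitone_det (lo hi : Fin n → ℤ) (hlo : Antitone lo) (w : Fin n → ℤ → R)
    (C : Fin n → ℤ → Fin n → R)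
    (H : ∀ i j : Fin n, i.val + 1 = j.val → ∀ b, lo i ≤ b → b ≤ hi i →
      ∃ κ : R, ∑ ν ∈ Finset.Ioc b (hi j), w j ν • C j ν = κ • C i b) :
    ∑ ν ∈ Fintype.piFinset (fun j => Finset.Icc (lo j) (hi j)) with
        ∀ i j : Fin n, i.val + 1 = j.val → ν j ≤ ν i,
      (∏ j, w j (ν j)) * (Matrix.of fun j => C j (ν j)).det =
    (Matrix.of fun j => ∑ ν ∈ Finset.Icc (lo j) (hi j), w j ν • C j ν).det := by
  classical
  set D : (Fin n → R) [⋀^Fin n]→ₗ[R] R := Matrix.detRowAlternating with hD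
  set box := Fintype.piFinset (fun j => Finset.Icc (lo j) (hi j)) with hbox
  let f : (Fin n → ℤ) → R := fun ν => D fun j => w j (ν j) • C j (ν j)
  have hf : ∀ ν, (∏ j, w j (ν j)) * (Matrix.of fun j => C j (ν j)).det = f ν := by
    intro ν
    exact (D.toMultilinearMap.map_smul_univ (fun j => w j (ν j)) (fun j => C j (ν j))).symm
  simp only [hf]
  have hall : (Matrix.of fun j => ∑ ν ∈ Finset.Icc (lo j) (hi j), w j ν • C j ν).det =
      ∑ ν ∈ box, f ν :=
    D.toMultilinearMap.map_sum_finset (fun j ν => w j ν • C j ν)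
      fun j => Finset.Icc (lo j) (hi j)
  rw [hall]
  -- The inequalities are dropped one at a time, the last one first. When `ν_j ≤ ν_i` is dropped,
  -- `ν_j` occurs in no remaining inequality and can be summed freely.
  have key : ∀ m ≤ n, ∑ ν ∈ box with
      (∀ i j : Fin n, i.val + 1 = j.val → j.val < m → ν j ≤ ν i), f ν = ∑ ν ∈ box, f ν := by
    intro m
    induction m with
    | zero => intro _; simp
    | succ m ih =>
      intro hm
      rw [← ih (by omega)]
      rcases Nat.eq_zero_or_pos m with rfl | hpos
      · refine Finset.sum_congr (Finset.filter_congr fun ν _ => ?_) fun _ _ => rfl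
        exact ⟨fun _ i j _ hj => absurd hj (by omega), fun _ i j hij hj => absurd hij (by omega)⟩
      let i : Fin n := ⟨m - 1, by omega⟩
      let j : Fin n := ⟨m, by omega⟩
      have hij : i.val + 1 = j.val := by simp [i, j]; omega
      have hne : i ≠ j := by rintro h; rw [h] at hij; omega
      rw [← Finset.sum_filter_add_sum_filter_not
        (box.filter fun ν => ∀ i j : Fin n, i.val + 1 = j.val → j.val < m → ν j ≤ ν i)
        (fun ν => ν j ≤ ν i) f, Finset.filter_filter, Finset.filter_filter]
      have hz : ∑ ν ∈ box with ((∀ i j : Fin n, i.val + 1 = j.val → j.val < m → ν j ≤ ν i) ∧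
          ¬ ν j ≤ ν i), f ν = 0 := by
        refine sum_piFinset_filter_eq_zero _ j _ f fun ν hν => ?_
        rw [Fintype.mem_piFinset] at hν
        have hνi := Finset.mem_Icc.1 (hν i)
        by_cases hc : ∀ i j : Fin n, i.val + 1 = j.val → j.val < m → ν j ≤ ν i
        · obtain ⟨κ, hκ⟩ := H i j hij (ν i) hνi.1 hνi.2
          -- Antitonicity of `lo` ensures that the lower bound on `ν_j` is implied by `ν_j > ν_i`.
          have hset : (Finset.Icc (lo j) (hi j)).filter (fun c =>
              (∀ i' j' : Fin n, i'.val + 1 = j'.val → j'.val < m →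
                Function.update ν j c j' ≤ Function.update ν j c i') ∧
              ¬ Function.update ν j c j ≤ Function.update ν j c i) =
              Finset.Ioc (ν i) (hi j) := by
            ext c
            have h1 : lo j ≤ lo i := hlo (Fin.le_def.2 (by omega))
            simp only [Finset.mem_filter, Finset.mem_Icc, Finset.mem_Ioc, Function.update_self,
              Function.update_of_ne hne]
            constructor
            · rintro ⟨h2, -, h3⟩
              omega
            · rintro ⟨h2, h3⟩
              refine ⟨by omega, fun i' j' hij' hj' => ?_, by omega⟩
              have e1 : i' ≠ j := by rintro rfl; simp [j] at hij'; omega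
              have e2 : j' ≠ j := by rintro rfl; simp [j] at hj'
              rw [Function.update_of_ne e1, Function.update_of_ne e2]
              exact hc i' j' hij' hj'
          rw [hset]
          set v : Fin n → Fin n → R := fun l => w l (ν l) • C l (ν l) with hv
          have hfu : ∀ c, f (Function.update ν j c) = D (Function.update v j (w j c • C j c)) := by
            intro c
            simp only [f]
            congr 1
            ext l : 1
            rcases eq_or_ne l j with rfl | hl
            · simp
            · simp [hl, hv]
          simp only [hfu]
          rw [← D.map_update_sum, hκ, D.map_update_smul]
          -- After summation, row `j` is a multiple of `C i (ν i)`, and row `i` is one too. Both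
          -- scalars are pulled out, leaving two equal rows.
          have : Function.update v j (C i (ν i)) =
              Function.update (Function.update v j (C i (ν i))) i (w i (ν i) • C i (ν i)) := by
            rw [eq_comm, Function.update_eq_self_iff, Function.update_of_ne hne]
          rw [this, D.map_update_smul, D.map_eq_zero_of_eq _ (i := i) (j := j) ?_ hne]
          · simp
          · simp [hne.symm]
        · refine Finset.sum_eq_zero fun c hc' => ?_
          exfalso
          apply hc
          intro i' j' hij' hj'
          have e1 : i' ≠ j := by rintro rfl; simp [j] at hij'; omega
          have e2 : j' ≠ j := by rintro rfl; simp [j] at hj'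
          simpa [e1, e2] using (Finset.mem_filter.1 hc').2.1 i' j' hij' hj'
      rw [hz, add_zero]
      refine Finset.sum_congr (Finset.filter_congr fun ν _ => ?_) fun _ _ => rfl
      constructor
      · intro h
        exact ⟨fun i j hij hj => h i j hij (by omega), h i j hij (by simp [j])⟩
      · rintro ⟨h1, h2⟩ i' j' hij' hj'
        rcases Nat.lt_succ_iff_lt_or_eq.1 hj' with h3 | h3
        · exact h1 i' j' hij' h3
        · have e1 : i' = i := by ext; simp [i]; omega
          have e2 : j' = j := by ext; simp [j]; omega
          rw [e1, e2]; exact h2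
  rw [← key n le_rfl]
  refine Finset.sum_congr (Finset.filter_congr fun ν _ => ?_) fun _ _ => rfl
  exact ⟨fun h i j hij _ => h i j hij, fun h i j hij => h i j hij j.2⟩

/-- Iterating the recurrence for `g` from `b` up to `K` produces the sum, with a remainder at `K`.
-/
theorem sum_Ioc_telescope {V : Type*} [AddCommGroup V] [Module R V] (e : ℤ → R) (f g : ℤ → V)
    (K : ℤ) (hg : ∀ b < K, g b = f (b + 1) + e (b + 1) • g (b + 1)) (b : ℤ) (hb : b ≤ K) :
    ∑ ν ∈ Finset.Ioc b K, (∏ c ∈ Finset.Ioo b ν, e c) • f ν =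
      g b - (∏ c ∈ Finset.Ioc b K, e c) • g K := by
  induction b, hb using Int.leInductionDown with
  | base => simp
  | pred b hb ih =>
    have h1 : Finset.Ioc (b - 1) K = insert b (Finset.Ioc b K) := by
      ext c; simp only [Finset.mem_Ioc, Finset.mem_insert]; omega
    have h2 : ∀ ν ∈ Finset.Ioc b K, (∏ c ∈ Finset.Ioo (b - 1) ν, e c) • f ν =
        e b • (∏ c ∈ Finset.Ioo b ν, e c) • f ν := by
      intro ν hν
      rw [Finset.mem_Ioc] at hν
      have : Finset.Ioo (b - 1) ν = insert b (Finset.Ioo b ν) := by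
        ext c; simp only [Finset.mem_Ioo, Finset.mem_insert]; omega
      rw [this, Finset.prod_insert (by simp), mul_smul]
    have h3 : Finset.Ioo (b - 1) b = ∅ := by
      ext c; simp only [Finset.mem_Ioo, Finset.notMem_empty, iff_false]; omega
    have h4 := hg (b - 1) (by omega)
    rw [sub_add_cancel] at h4
    rw [h1, Finset.sum_insert (by simp), Finset.prod_insert (by simp), h3, Finset.sum_congr rfl h2,
      ← Finset.smul_sum, ih, h4, mul_smul, smul_sub]
    simp only [Finset.prod_empty, one_smul]
    abel

end Determinants

/-! ### Coefficients of power series -/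

section Series

variable {R : Type*} [CommRing R]

/-- The unit `1 - v t` of the ring of power series in `t`. -/
noncomputable def linUnit (v : R) : (PowerSeries R)ˣ where
  val := 1 - PowerSeries.C v * PowerSeries.X
  inv := PowerSeries.mk fun n => v ^ n
  val_inv := by
    rw [mul_comm]
    ext n
    cases n with
    | zero => simp [mul_sub]
    | succ n => simp [mul_sub, ← mul_assoc, PowerSeries.coeff_succ_mul_X, PowerSeries.coeff_one,
        pow_succ]
  inv_val := by
    ext n
    cases n with
    | zero => simp [mul_sub]
    | succ n => simp [mul_sub, ← mul_assoc, PowerSeries.coeff_succ_mul_X, PowerSeries.coeff_one,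
        pow_succ]

theorem val_linUnit (v : R) :
    (linUnit v : PowerSeries R) = 1 - PowerSeries.C v * PowerSeries.X := rfl

theorem linUnit_zero : linUnit (0 : R) = 1 := by
  ext : 1
  simp [val_linUnit]

/-- The coefficient of `t ^ m`, which is `0` for `m < 0`. -/
noncomputable def coeffZ (m : ℤ) (f : PowerSeries R) : R :=
  if 0 ≤ m then PowerSeries.coeff m.toNat f else 0

theorem coeffZ_of_neg {m : ℤ} (hm : m < 0) (f : PowerSeries R) : coeffZ m f = 0 :=
  if_neg (not_le.2 hm)

theorem coeffZ_linUnit_mul (m : ℤ) (v : R) (f : (PowerSeries R)ˣ) :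
    coeffZ m (linUnit v * f : (PowerSeries R)ˣ) = coeffZ m f - v * coeffZ (m - 1) f := by
  rcases lt_trichotomy m 0 with hm | rfl | hm
  · rw [coeffZ_of_neg hm, coeffZ_of_neg hm, coeffZ_of_neg (by omega)]
    simp
  · simp [coeffZ, val_linUnit]
  · obtain ⟨d, rfl⟩ : ∃ d : ℕ, m = d + 1 := ⟨(m - 1).toNat, by omega⟩
    have h1 : ((d : ℤ) + 1).toNat = d + 1 := by omega
    have h2 : (0 : ℤ) ≤ d + 1 := by omega
    rw [coeffZ, coeffZ, coeffZ, add_sub_cancel_right, if_pos h2, if_pos h2,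
      if_pos (Int.natCast_nonneg d), h1, Int.toNat_natCast, Units.val_mul, val_linUnit, sub_mul,
      one_mul, map_sub, mul_assoc, PowerSeries.coeff_C_mul, PowerSeries.coeff_succ_X_mul]

theorem coeffZ_one_of_pos {m : ℤ} (hm : 0 < m) : coeffZ m (1 : PowerSeries R) = 0 := by
  rw [coeffZ, if_pos hm.le, PowerSeries.coeff_one, if_neg (by omega)]

/-- The constant coefficient as a homomorphism on units. -/
noncomputable def constUnit : (PowerSeries R)ˣ →* Rˣ :=
  Units.map (PowerSeries.constantCoeff : PowerSeries R →+* R)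

theorem constUnit_linUnit (v : R) : constUnit (linUnit v) = 1 := by
  ext
  simp [constUnit, val_linUnit]

theorem coeffZ_zero_of_constUnit {f : (PowerSeries R)ˣ} (hf : constUnit f = 1) :
    coeffZ 0 (f : PowerSeries R) = 1 := by
  have := congrArg Units.val hf
  simpa [constUnit, coeffZ] using this

end Series

/-! ### The entries of the Jacobi-Trudi matrix -/

/-- The parameters of a weighted enumeration: `α` is indexed by columns, `β` by rows, and each
letter `k` carries a bosonic variable `p k` and a fermionic variable `y k`. The series `𝒜` and `ℬ`
are the products of the factors `1 - α_c t` and `1 - β_i t`, up to a constant. -/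
structure Weights (R : Type*) [CommRing R] where
  /-- column parameters -/
  α : ℤ → R
  /-- row parameters, `β i` belonging to the rows `i` and `i + 1` -/
  β : ℕ → R
  /-- bosonic variables -/
  p : ℤ → R
  /-- fermionic variables -/
  y : ℤ → R
  /-- partial products of the factors `1 - α_c t` -/
  𝒜 : ℤ → (PowerSeries R)ˣ
  /-- partial products of the factors `1 - β_i t` -/
  ℬ : ℕ → (PowerSeries R)ˣ
  𝒜_succ : ∀ c, 𝒜 (c + 1) = 𝒜 c * linUnit (α (c + 1))
  ℬ_succ : ∀ i, ℬ (i + 1) = ℬ i * linUnit (β i)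

namespace Weights

variable {R : Type*} [CommRing R] (W : Weights R)

/-- The generating function `(1 + y_k t) / (1 - p_k t)` of the letter `k`. -/
noncomputable def letter (k : ℤ) : (PowerSeries R)ˣ := linUnit (-W.y k) * (linUnit (W.p k))⁻¹

/-- The generating function of the letters `a, …, b`, the columns from `m` to `l` and the rows
from `j` to `i`. -/
noncomputable def series (a b l m : ℤ) (i j : ℕ) : (PowerSeries R)ˣ :=
  (∏ k ∈ Finset.Icc a b, W.letter k) * W.𝒜 (l - 1) * (W.𝒜 m)⁻¹ * W.ℬ j * (W.ℬ i)⁻¹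

/-- The entries of the Jacobi-Trudi matrix. -/
noncomputable def entry (a b l m : ℤ) (i j : ℕ) : R :=
  coeffZ (l - m - i + j) (W.series a b l m i j : PowerSeries R)

/-- The coefficient of degree one less, with one more bosonic variable `p_k`. -/
noncomputable def auxEntry (k a b l m : ℤ) (i j : ℕ) : R :=
  coeffZ (l - m - i + j - 1)
    ((linUnit (W.p k))⁻¹ * W.series a b l m i j : (PowerSeries R)ˣ)

theorem entry_eq_zero {a b l m : ℤ} {i j : ℕ} (h : l - m - i + j < 0) :
    W.entry a b l m i j = 0 := coeffZ_of_neg h _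

theorem auxEntry_eq_zero {k a b l m : ℤ} {i j : ℕ} (h : l - m - i + j < 1) :
    W.auxEntry k a b l m i j = 0 := coeffZ_of_neg (by omega) _

theorem constUnit_letter (k : ℤ) : constUnit (W.letter k) = 1 := by
  simp [letter, constUnit_linUnit]

theorem entry_diag (a b l : ℤ) (i : ℕ) : W.entry a b l l i i = 1 := by
  have h0 : l - l - (i : ℤ) + i = 0 := by ring
  rw [entry, h0]
  apply coeffZ_zero_of_constUnit
  have h1 := W.𝒜_succ (l - 1)
  rw [sub_add_cancel] at h1
  rw [series, h1]
  simp [constUnit_linUnit, constUnit_letter]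

theorem series_succ_col (a b l m : ℤ) (i j : ℕ) :
    W.series a b l m i j = linUnit (W.α (m + 1)) * W.series a b l (m + 1) i j := by
  rw [series, series, W.𝒜_succ m, mul_inv]
  generalize linUnit (W.α (m + 1)) = u
  simp only [mul_assoc, mul_left_comm u]
  rw [mul_left_comm (W.ℬ j) u, inv_mul_cancel_left]

theorem series_succ_row (a b l m : ℤ) (i j : ℕ) :
    W.series a b l m i (j + 1) = linUnit (W.β j) * W.series a b l m i j := by
  rw [series, series, W.ℬ_succ j]
  simp only [mul_assoc, mul_left_comm (linUnit (W.β j))]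

theorem series_letter {a b : ℤ} (hab : a ≤ b) (l m : ℤ) (i j : ℕ) :
    W.series a b l m i j = W.letter a * W.series (a + 1) b l m i j := by
  have : Finset.Icc a b = insert a (Finset.Icc (a + 1) b) := by
    ext c; simp only [Finset.mem_Icc, Finset.mem_insert]; omega
  rw [series, series, this, Finset.prod_insert (by simp)]
  simp only [mul_assoc]

/-- With `F` the series at `m + 1` and `j`, this is `(1 - αt)F = (1 - βt)F + (β - α)tF`. Raising `m`
and `j` together leaves the degree unchanged. -/
theorem entry_eq_add_succ (a b l m : ℤ) (i j : ℕ) :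
    W.entry a b l m i j = W.entry a b l (m + 1) i (j + 1) +
      (W.β j - W.α (m + 1)) * W.entry a b l (m + 1) i j := by
  rw [entry, entry, entry, W.series_succ_col a b l m, W.series_succ_row, coeffZ_linUnit_mul,
    coeffZ_linUnit_mul]
  have h1 : l - (m + 1) - (i : ℤ) + ((j + 1 : ℕ) : ℤ) = l - m - i + j := by push_cast; ring
  have h2 : l - (m + 1) - (i : ℤ) + j = l - m - i + j - 1 := by ring
  rw [h1, h2]
  ring

/-- Coefficient form of `(1 - αt)/(1 - pt) = 1 + (p - α)t/(1 - pt)`. -/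
theorem auxEntry_eq_add (k a b l m : ℤ) (i j : ℕ) :
    W.auxEntry k a b l m i j = W.entry a b l (m + 1) i j +
      (W.p k - W.α (m + 1)) * W.auxEntry k a b l (m + 1) i j := by
  have h0 : W.series a b l (m + 1) i j =
      linUnit (W.p k) * ((linUnit (W.p k))⁻¹ * W.series a b l (m + 1) i j) := by simp
  rw [auxEntry, auxEntry, entry, W.series_succ_col a b l m,
    mul_left_comm _ (linUnit (W.α (m + 1)))]
  nth_rewrite 2 [h0]
  rw [coeffZ_linUnit_mul, coeffZ_linUnit_mul]
  have h2 : l - (m + 1) - (i : ℤ) + j = l - m - i + j - 1 := by ring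
  rw [h2]
  ring

/-- Coefficient form of `(1 + yt)/(1 - pt) = 1 + (p + y)t/(1 - pt)`. -/
theorem entry_letter {k b : ℤ} (hkb : k ≤ b) (l m : ℤ) (i j : ℕ) :
    W.entry k b l m i j = W.entry (k + 1) b l m i j +
      (W.p k + W.y k) * W.auxEntry k (k + 1) b l m i j := by
  have h0 : W.series (k + 1) b l m i j =
      linUnit (W.p k) * ((linUnit (W.p k))⁻¹ * W.series (k + 1) b l m i j) := by simp
  rw [auxEntry, entry, entry, W.series_letter hkb, letter, mul_assoc]
  nth_rewrite 2 [h0]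
  rw [coeffZ_linUnit_mul, coeffZ_linUnit_mul]
  ring

/-- Over the denominator `1 - pt` this is `(β + y)(1 - pt) - (p + y)(1 - βt) = (β - p)(1 + yt)`. -/
theorem entry_sub_auxEntry {k b : ℤ} (hkb : k ≤ b) (l m : ℤ) (i j : ℕ) :
    (W.β j + W.y k) * W.entry (k + 1) b l m i j -
      (W.p k + W.y k) * W.auxEntry k (k + 1) b l m i (j + 1) =
    (W.β j - W.p k) * W.entry k b l m i j := by
  have h0 : W.series (k + 1) b l m i j =
      linUnit (W.p k) * ((linUnit (W.p k))⁻¹ * W.series (k + 1) b l m i j) := by simp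
  rw [auxEntry, entry, entry, W.series_letter hkb, letter, mul_assoc, W.series_succ_row,
    mul_left_comm _ (linUnit (W.β j))]
  nth_rewrite 1 [h0]
  rw [coeffZ_linUnit_mul, coeffZ_linUnit_mul, coeffZ_linUnit_mul]
  have h1 : l - m - (i : ℤ) + ((j + 1 : ℕ) : ℤ) - 1 = l - m - i + j := by push_cast; ring
  rw [h1]
  ring

/-- Without letters the series is a product of `d + d'` linear factors, hence a polynomial of degree
at most `d + d'`. -/
theorem coeffZ_series_eq_zero (l m : ℤ) (d d' i : ℕ) (hl : l - 1 = m + d) {a b : ℤ} (hab : b < a)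
    (z : ℤ) (hz : d + d' < z) :
    coeffZ z (W.series a b l m i (i + d') : PowerSeries R) = 0 := by
  induction d' generalizing z with
  | succ d' ih =>
    rw [← add_assoc, W.series_succ_row, coeffZ_linUnit_mul, ih z (by push_cast at hz; omega),
      ih (z - 1) (by push_cast at hz; omega)]
    simp
  | zero =>
    induction d generalizing z m with
    | succ d ih =>
      rw [W.series_succ_col, coeffZ_linUnit_mul, ih (m + 1) (by push_cast at hl; omega) z
        (by push_cast at hz; omega), ih (m + 1) (by push_cast at hl; omega) (z - 1)
        (by push_cast at hz; omega)]
      simp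
    | zero =>
      have h1 : W.series a b l m i (i + 0) = 1 := by
        have : l - 1 = m := by simpa using hl
        simp [series, this, Finset.Icc_eq_empty_of_lt hab]
      rw [h1]
      exact coeffZ_one_of_pos (by simpa using hz)

theorem entry_eq_zero_of_lt {a b l m : ℤ} {i j : ℕ} (hab : b < a) (hm : m < l) (hij : i ≤ j) :
    W.entry a b l m i j = 0 := by
  obtain ⟨d', rfl⟩ := Nat.exists_eq_add_of_le hij
  obtain ⟨d, hd⟩ := Int.le.dest (show m ≤ l - 1 by omega)
  exact W.coeffZ_series_eq_zero l m d d' i hd.symm hab _ (by push_cast; omega)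

end Weights

/-! ### Blocks of a skew shape -/

section Blocks

variable {n : ℕ}

open Classical in
/-- The number of rows `l < i` of the skew shape `lam / mu` that have no column in common with the
row below. -/
noncomputable def block (lam mu : Fin n → ℤ) (i : Fin n) : ℕ :=
  (Finset.univ.filter fun l : Fin n => l < i ∧ ∃ l' : Fin n, l.val + 1 = l'.val ∧
    lam l' ≤ mu l).card

variable {lam mu : Fin n → ℤ}

theorem block_mono : Monotone (block lam mu) := fun _ _ hij =>
  Finset.card_le_card fun _ hl => by
    simp only [Finset.mem_filter, Finset.mem_univ, true_and] at hl ⊢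
    exact ⟨hl.1.trans_le hij, hl.2⟩

theorem block_lt {i j : Fin n} (hij : i.val + 1 = j.val) (h : lam j ≤ mu i) :
    block lam mu i < block lam mu j := by
  refine Finset.card_lt_card (Finset.ssubset_iff.2 ⟨i, by simp, fun l hl => ?_⟩)
  simp only [Finset.mem_insert, Finset.mem_filter, Finset.mem_univ, true_and] at hl ⊢
  have h1 : i < j := Fin.lt_def.2 (by omega)
  rcases hl with rfl | hl
  · exact ⟨h1, j, hij, h⟩
  · exact ⟨hl.1.trans h1, hl.2⟩

theorem block_eq {i j : Fin n} (hij : i.val + 1 = j.val) (h : mu i < lam j) :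
    block lam mu i = block lam mu j := by
  unfold block
  congr 1
  ext l
  simp only [Finset.mem_filter, Finset.mem_univ, true_and, and_congr_left_iff]
  rintro ⟨l', hl', hl⟩
  rw [Fin.lt_def, Fin.lt_def]
  refine ⟨fun _ => by omega, fun h1 => ?_⟩
  by_contra h2
  have h3 : l = i := Fin.ext (by omega)
  have h4 : l' = j := Fin.ext (by omega)
  subst h3 h4
  omega

/-- Some row `l` between `j` and `i` shares no column with the next one, so `lam i ≤ lam (l + 1) ≤
mu l ≤ mu j`. -/
theorem le_of_block_lt (hlam : Antitone lam) (hmu : Antitone mu) {i j : Fin n}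
    (h : block lam mu j < block lam mu i) : j < i ∧ lam i ≤ mu j := by
  classical
  have hji : j < i := lt_of_not_ge fun hle => (block_mono hle).not_gt h
  obtain ⟨l, hl, hl'⟩ := Finset.exists_mem_notMem_of_card_lt_card h
  simp only [Finset.mem_filter, Finset.mem_univ, true_and, not_and] at hl hl'
  obtain ⟨hli, l', hll', hle⟩ := hl
  have hjl : j ≤ l := by
    by_contra hlt
    exact hl' (not_le.1 hlt) ⟨l', hll', hle⟩
  refine ⟨hji, ?_⟩
  calc lam i ≤ lam l' := hlam (Fin.le_def.2 (by rw [Fin.lt_def] at hli; omega))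
    _ ≤ mu l := hle
    _ ≤ mu j := hmu hjl

theorem block_lt_of_first {i j : Fin n} (hj : ∀ i : Fin n, i.val + 1 = j.val → lam j ≤ mu i)
    (hij : i < j) : block lam mu i < block lam mu j := by
  rw [Fin.lt_def] at hij
  let i' : Fin n := ⟨j.val - 1, by omega⟩
  have h1 : i'.val + 1 = j.val := by simp [i']; omega
  exact (block_mono (Fin.le_def.2 (by omega))).trans_lt (block_lt h1 (hj i' h1))

end Blocks

namespace Weights

variable {R : Type*} [CommRing R] (W : Weights R) {n : ℕ}

/-! ### The Jacobi-Trudi determinant -/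

/-- The Jacobi-Trudi determinant. -/
noncomputable def jtDet (lam mu r s : Fin n → ℤ) : R :=
  (Matrix.of fun i j : Fin n => W.entry (r j) (s i) (lam i) (mu j) i j).det

/-- The mask comes from `lam / mu` although the entries use the larger `nu`, so that one mask serves
all shapes arising when a letter is removed. -/
theorem jtDet_eq_mask {lam mu : Fin n → ℤ} (hlam : Antitone lam) (hmu : Antitone mu)
    (nu r s : Fin n → ℤ) (hnu : ∀ j, mu j ≤ nu j) :
    W.jtDet lam nu r s = (Matrix.of fun i j : Fin n =>
      if block lam mu i = block lam mu j then W.entry (r j) (s i) (lam i) (nu j) i j else 0).det :=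
  det_eq_det_mask _ _ fun i j hij => by
    obtain ⟨h1, h2⟩ := le_of_block_lt hlam hmu hij
    rw [Fin.lt_def] at h1
    have := hnu j
    exact W.entry_eq_zero (by omega)

/-- If `lam k < mu k`, the masked row `k` vanishes: up to the diagonal the degrees are negative, and
beyond it another block begins. -/
theorem jtDet_eq_zero_of_not_le {lam mu : Fin n → ℤ} (hlam : Antitone lam) (hmu : Antitone mu)
    (r s : Fin n → ℤ) (h : ¬ mu ≤ lam) : W.jtDet lam mu r s = 0 := by
  rw [Pi.le_def] at h
  push Not at h
  obtain ⟨k, hk⟩ := h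
  rw [W.jtDet_eq_mask hlam hmu mu r s fun _ => le_rfl]
  refine Matrix.det_eq_zero_of_row_eq_zero k fun j => ?_
  rw [Matrix.of_apply]
  split_ifs with hb
  · rcases lt_trichotomy j k with hj | rfl | hj
    · have := hmu hj.le
      rw [Fin.lt_def] at hj
      exact W.entry_eq_zero (by omega)
    · exact W.entry_eq_zero (by omega)
    · rw [Fin.lt_def] at hj
      let k' : Fin n := ⟨k.val + 1, by omega⟩
      have h1 := hlam (show k ≤ k' from Fin.le_def.2 (by simp [k']))
      have h2 := block_lt (lam := lam) (mu := mu) (show k.val + 1 = k'.val from rfl) (by omega)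
      have h3 := block_mono (lam := lam) (mu := mu)
        (show k' ≤ j from Fin.le_def.2 (by simp [k']; omega))
      omega
  · rfl

/-- The first nonempty row with `s i < k` starts a block, since otherwise monotonicity of `s` would
make the row above another such row. Its masked entries lie at `j ≥ i` and involve no letters, so
their degrees are too large. -/
theorem jtDet_eq_zero_of_empty_flag {lam mu : Fin n → ℤ} (hlam : Antitone lam) (hmu : Antitone mu)
    (r s : Fin n → ℤ) {k : ℤ} (hr : ∀ j, k ≤ r j)
    (hs : ∀ i j : Fin n, i.val + 1 = j.val → mu i < lam j → s i ≤ s j)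
    (h : ∃ i, mu i < lam i ∧ s i < k) : W.jtDet lam mu r s = 0 := by
  obtain ⟨i, ⟨hi, hik⟩, hmin⟩ := WellFounded.has_min (wellFounded_lt (α := Fin n))
    {i | mu i < lam i ∧ s i < k} h
  have hfirst : ∀ i' : Fin n, i'.val + 1 = i.val → lam i ≤ mu i' := by
    intro i' hi'
    by_contra hlt
    have hle : i' < i := Fin.lt_def.2 (by omega)
    have h1 := hs i' i hi' (not_le.1 hlt)
    have h2 := hlam hle.le
    exact hmin i' ⟨by omega, by omega⟩ hle
  rw [W.jtDet_eq_mask hlam hmu mu r s fun _ => le_rfl]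
  refine Matrix.det_eq_zero_of_row_eq_zero i fun j => ?_
  rw [Matrix.of_apply]
  split_ifs with hb
  · rcases lt_or_ge j i with hj | hj
    · exact absurd hb (block_lt_of_first hfirst hj).ne'
    · have h1 := hmu hj
      have h2 := hr j
      exact W.entry_eq_zero_of_lt (by omega) (by omega) (Fin.le_def.1 hj)
  · rfl

theorem block_eq_iff_of_empty {lam mu : Fin n → ℤ} (hlam : Antitone lam) (hmu : Antitone mu)
    {i : Fin n} (h : lam i = mu i) (j : Fin n) :
    block lam mu i = block lam mu j ↔ i = j := by
  refine ⟨fun hb => ?_, fun h => by rw [h]⟩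
  rcases lt_trichotomy j i with hj | rfl | hj
  · refine absurd hb (block_lt_of_first (fun i' hi' => ?_) hj).ne'
    rw [h]
    exact hmu (Fin.le_def.2 (by omega))
  · rfl
  · exfalso
    rw [Fin.lt_def] at hj
    let i' : Fin n := ⟨i.val + 1, by omega⟩
    have h1 := hlam (show i ≤ i' from Fin.le_def.2 (by simp [i']))
    have h2 := block_lt (lam := lam) (mu := mu) (show i.val + 1 = i'.val from rfl) (by omega)
    have h3 := block_mono (lam := lam) (mu := mu)
      (show i' ≤ j from Fin.le_def.2 (by simp [i']; omega))
    omega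

/-- An empty row is a block by itself with diagonal entry `1`, so its flag is irrelevant. -/
theorem jtDet_congr_flag {lam mu : Fin n → ℤ} (hlam : Antitone lam) (hmu : Antitone mu)
    (r s s' : Fin n → ℤ) (h : ∀ i, lam i = mu i ∨ s i = s' i) :
    W.jtDet lam mu r s = W.jtDet lam mu r s' := by
  rw [W.jtDet_eq_mask hlam hmu mu r s fun _ => le_rfl,
    W.jtDet_eq_mask hlam hmu mu r s' fun _ => le_rfl]
  congr 1
  ext i j
  rw [Matrix.of_apply, Matrix.of_apply]
  rcases h i with h | h
  · simp only [block_eq_iff_of_empty hlam hmu h]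
    split_ifs with hij
    · subst hij
      rw [h, entry_diag, entry_diag]
    · rfl
  · rw [h]

theorem jtDet_self {lam : Fin n → ℤ} (hlam : Antitone lam) (r s : Fin n → ℤ) :
    W.jtDet lam lam r s = 1 := by
  rw [W.jtDet_eq_mask hlam hlam lam r s fun _ => le_rfl, ← Matrix.det_one (n := Fin n)]
  congr 1
  ext i j
  rw [Matrix.of_apply, Matrix.one_apply]
  simp only [block_eq_iff_of_empty hlam hlam rfl]
  split_ifs with hij
  · rw [hij, entry_diag]
  · rfl

/-! ### Removing the smallest letter -/

open Classical in
/-- The weight of the cells in row `j` and the columns `mu j + 1, …, ν`, all filled with `k`, if the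
columns of the row above are filled with `k` from `mu (j - 1) + 1` on. -/
noncomputable def rowWeight (mu : Fin n → ℤ) (k : ℤ) (j : Fin n) (ν : ℤ) : R :=
  ∏ c ∈ Finset.Ioc (mu j) ν,
    ((if ∃ i : Fin n, i.val + 1 = j.val ∧ mu i < c then W.β (j.val - 1) else W.p k) +
      if c < ν then -W.α c else W.y k)

theorem prod_Ioc_eq_mul {a ν : ℤ} (h : a < ν) (f : ℤ → R) :
    ∏ c ∈ Finset.Ioc a ν, f c = (∏ c ∈ Finset.Ioo a ν, f c) * f ν := by
  have : Finset.Ioc a ν = insert ν (Finset.Ioo a ν) := by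
    ext c; simp only [Finset.mem_Ioc, Finset.mem_Ioo, Finset.mem_insert]; omega
  rw [this, Finset.prod_insert (by simp), mul_comm]

theorem prod_Ioc_mul_prod_Ioo {a b ν : ℤ} (hab : a ≤ b) (hb : b < ν) (f : ℤ → R) :
    ∏ c ∈ Finset.Ioo a ν, f c = (∏ c ∈ Finset.Ioc a b, f c) * ∏ c ∈ Finset.Ioo b ν, f c := by
  rw [← Finset.prod_union]
  · congr 1
    ext c; simp only [Finset.mem_Ioc, Finset.mem_Ioo, Finset.mem_union]; omega
  · rw [Finset.disjoint_left]
    intro c hc hc'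
    rw [Finset.mem_Ioc] at hc
    rw [Finset.mem_Ioo] at hc'
    omega

theorem rowWeight_self (mu : Fin n → ℤ) (k : ℤ) (j : Fin n) : W.rowWeight mu k j (mu j) = 1 := by
  simp [rowWeight]

theorem rowWeight_of_le (mu : Fin n → ℤ) (k : ℤ) {j : Fin n} {ν : ℤ} (h : mu j < ν)
    (hν : ∀ i : Fin n, i.val + 1 = j.val → ν ≤ mu i) :
    W.rowWeight mu k j ν = (∏ c ∈ Finset.Ioo (mu j) ν, (W.p k - W.α c)) * (W.p k + W.y k) := by
  have hno : ∀ c ≤ ν, ¬ ∃ i : Fin n, i.val + 1 = j.val ∧ mu i < c := by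
    rintro c hc ⟨i, hi, hlt⟩
    have := hν i hi
    omega
  rw [rowWeight, prod_Ioc_eq_mul h, if_neg (hno ν le_rfl), if_neg (lt_irrefl ν)]
  congr 1
  refine Finset.prod_congr rfl fun c hc => ?_
  rw [Finset.mem_Ioo] at hc
  rw [if_neg (hno c hc.2.le), if_pos hc.2, sub_eq_add_neg]

/-- Cells past column `mu i` lie below another `k`, so `β i` replaces `p k`. Splitting at `b`
isolates the last product, the only factor depending on `ν`, in the form needed for
`sum_Ioc_telescope`. -/
theorem rowWeight_of_lt {mu : Fin n → ℤ} (hmu : Antitone mu) (k : ℤ) {i j : Fin n}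
    (hij : i.val + 1 = j.val) {b ν : ℤ} (hb : mu i ≤ b) (hν : b < ν) :
    W.rowWeight mu k j ν = (∏ c ∈ Finset.Ioc (mu j) (mu i), (W.p k - W.α c)) *
      (∏ c ∈ Finset.Ioc (mu i) b, (W.β i - W.α c)) * (W.β i + W.y k) *
      ∏ c ∈ Finset.Ioo b ν, (W.β i - W.α c) := by
  have h1 : mu j ≤ mu i := hmu (Fin.le_def.2 (by omega))
  have hi : j.val - 1 = i.val := by omega
  have hiff : ∀ c, (∃ i : Fin n, i.val + 1 = j.val ∧ mu i < c) ↔ mu i < c := by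
    refine fun c => ⟨?_, fun h => ⟨i, hij, h⟩⟩
    rintro ⟨i', hi', h⟩
    rwa [Fin.ext (show i.val = i'.val by omega)]
  rw [rowWeight, prod_Ioc_eq_mul (by omega), prod_Ioc_mul_prod_Ioo h1 (by omega),
    prod_Ioc_mul_prod_Ioo hb hν]
  simp only [hiff, hi]
  rw [if_pos (show mu i < ν by omega), if_neg (lt_irrefl ν)]
  have e1 : ∀ c ∈ Finset.Ioc (mu j) (mu i), ((if mu i < c then W.β i else W.p k) +
      if c < ν then -W.α c else W.y k) = W.p k - W.α c := by
    intro c hc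
    rw [Finset.mem_Ioc] at hc
    rw [if_neg (by omega), if_pos (by omega), sub_eq_add_neg]
  have e2 : ∀ c ∈ Finset.Ioc (mu i) b, ((if mu i < c then W.β i else W.p k) +
      if c < ν then -W.α c else W.y k) = W.β i - W.α c := by
    intro c hc
    rw [Finset.mem_Ioc] at hc
    rw [if_pos (by omega), if_pos (by omega), sub_eq_add_neg]
  have e3 : ∀ c ∈ Finset.Ioo b ν, ((if mu i < c then W.β i else W.p k) +
      if c < ν then -W.α c else W.y k) = W.β i - W.α c := by
    intro c hc
    rw [Finset.mem_Ioo] at hc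
    rw [if_pos (by omega), if_pos (by omega), sub_eq_add_neg]
  rw [Finset.prod_congr rfl e1, Finset.prod_congr rfl e2, Finset.prod_congr rfl e3]
  ring

/-- Here `C` and `C'` are the columns after and before the letter `k` is removed, and `G` is the
auxiliary column. Terms in which a strip stays left of `mu (j - 1)` telescope through `G`; terms in
which it goes further telescope through column `j - 1` of `C`. The remainders combine by
`entry_sub_auxEntry`. The bound `lam i + n ≤ K` makes all degrees at `K` negative. -/
theorem jtDet_remove_letter {lam mu : Fin n → ℤ} (hlam : Antitone lam) (hmu : Antitone mu)
    (hle : mu ≤ lam) (r s : Fin n → ℤ) {k K : ℤ} (hK : ∀ i, lam i + n ≤ K) (hr : ∀ j, k ≤ r j)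
    (hs : ∀ i, k ≤ s i) (hflag : ∀ i j : Fin n, i.val + 1 = j.val → mu i < lam j → r i ≤ r j) :
    ∑ ν ∈ Fintype.piFinset
        (fun j : Fin n => Finset.Icc (mu j) (if r j = k then K else mu j)) with
        ∀ i j : Fin n, i.val + 1 = j.val → ν j ≤ ν i,
      (∏ j, W.rowWeight mu k j (ν j)) * W.jtDet lam ν (fun j => max (r j) (k + 1)) s =
    W.jtDet lam mu r s := by
  set r' : Fin n → ℤ := fun j => max (r j) (k + 1) with hr'
  have hr1 : ∀ j, r j = k → r' j = k + 1 := fun j hj => by simp [hr', hj]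
  have hr2 : ∀ j, r j ≠ k → r' j = r j := fun j hj => by
    have := hr j; simp only [hr']; omega
  have hlK : ∀ i, lam i ≤ K := fun i => by have := hK i; omega
  let msk : Fin n → (Fin n → R) → Fin n → R := fun j f i =>
    if block lam mu i = block lam mu j then f i else 0
  have hmsk_add : ∀ j f g, msk j (f + g) = msk j f + msk j g := by
    intro j f g; ext i; simp only [msk, Pi.add_apply]; split_ifs <;> simp
  have hmsk_smul : ∀ j (a : R) f, msk j (a • f) = a • msk j f := by
    intro j a f; ext i; simp only [msk, Pi.smul_apply]; split_ifs <;> simp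
  let C : Fin n → ℤ → Fin n → R := fun j ν =>
    msk j fun i => W.entry (r' j) (s i) (lam i) ν i j
  let C' : Fin n → ℤ → Fin n → R := fun j ν =>
    msk j fun i => W.entry (r j) (s i) (lam i) ν i j
  let G : Fin n → ℤ → Fin n → R := fun j ν =>
    msk j fun i => W.auxEntry k (k + 1) (s i) (lam i) ν i j
  have hdet : ∀ ν ∈ (Fintype.piFinset
        (fun j : Fin n => Finset.Icc (mu j) (if r j = k then K else mu j))).filter
        (fun ν => ∀ i j : Fin n, i.val + 1 = j.val → ν j ≤ ν i),
      (∏ j, W.rowWeight mu k j (ν j)) * W.jtDet lam ν r' s =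
      (∏ j, W.rowWeight mu k j (ν j)) * (Matrix.of fun j => C j (ν j)).det := by
    intro ν hν
    rw [Finset.mem_filter, Fintype.mem_piFinset] at hν
    rw [W.jtDet_eq_mask hlam hmu ν r' s fun j => (Finset.mem_Icc.1 (hν.1 j)).1,
      ← Matrix.det_transpose]
    rfl
  have hdet' : W.jtDet lam mu r s = (Matrix.of fun j => C' j (mu j)).det := by
    rw [W.jtDet_eq_mask hlam hmu mu r s fun j => le_rfl, ← Matrix.det_transpose]
    rfl
  -- the relations between the columns
  have hfirst : ∀ j : Fin n, (∀ i : Fin n, i.val + 1 = j.val → lam j ≤ mu i) →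
      ∀ ν, lam j < ν → C j ν = 0 := by
    intro j hj ν hν
    ext i
    simp only [C, msk, Pi.zero_apply]
    split_ifs with hb
    · rcases lt_or_ge i j with hij | hij
      · exact absurd hb (block_lt_of_first hj hij).ne
      · have := hlam hij
        rw [Fin.le_def] at hij
        exact W.entry_eq_zero (by omega)
    · rfl
  have hGfirst : ∀ j : Fin n, (∀ i : Fin n, i.val + 1 = j.val → lam j ≤ mu i) →
      G j (lam j) = 0 := by
    intro j hj
    ext i
    simp only [G, msk, Pi.zero_apply]
    split_ifs with hb
    · rcases lt_or_ge i j with hij | hij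
      · exact absurd hb (block_lt_of_first hj hij).ne
      · have := hlam hij
        rw [Fin.le_def] at hij
        exact W.auxEntry_eq_zero (by omega)
    · rfl
  have hCK : ∀ j, C j K = 0 := by
    intro j
    ext i
    simp only [C, msk, Pi.zero_apply]
    split_ifs with hb
    · have := hK i
      exact W.entry_eq_zero (by omega)
    · rfl
  have hCrel : ∀ i j : Fin n, i.val + 1 = j.val → mu i < lam j → r i = k → r j = k → ∀ b,
      C i b = C j (b + 1) + (W.β i - W.α (b + 1)) • C i (b + 1) := by
    intro i j hij hlt hi hj b
    have hb := block_eq hij hlt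
    simp only [C, hr1 i hi, hr1 j hj]
    have : msk j = msk i := by simp only [msk, hb]
    rw [this, ← hmsk_smul, ← hmsk_add]
    congr 1
    ext l
    rw [W.entry_eq_add_succ, ← hij]
    rfl
  have hGrel : ∀ j : Fin n, r j = k → ∀ b,
      G j b = C j (b + 1) + (W.p k - W.α (b + 1)) • G j (b + 1) := by
    intro j hj b
    simp only [C, G, hr1 j hj]
    rw [← hmsk_smul, ← hmsk_add]
    congr 1
    ext l
    rw [W.auxEntry_eq_add]
    rfl
  have hC'rel : ∀ j : Fin n, r j = k → ∀ b, C' j b = C j b + (W.p k + W.y k) • G j b := by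
    intro j hj b
    simp only [C, C', G, hr1 j hj, hj]
    rw [← hmsk_smul, ← hmsk_add]
    congr 1
    ext l
    rw [W.entry_letter (hs l)]
    rfl
  have hC'C : ∀ i j : Fin n, i.val + 1 = j.val → mu i < lam j → r i = k → ∀ b,
      (W.β i + W.y k) • C i b = (W.p k + W.y k) • G j b + (W.β i - W.p k) • C' i b := by
    intro i j hij hlt hi b
    have hb := block_eq hij hlt
    simp only [C, C', G, hr1 i hi, hi]
    have : msk j = msk i := by simp only [msk, hb]
    rw [this, ← hmsk_smul, ← hmsk_smul, ← hmsk_smul, ← hmsk_add]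
    congr 1
    ext l
    have := W.entry_sub_auxEntry (hs l) (lam l) b l i
    rw [hij] at this
    simp only [Pi.add_apply, Pi.smul_apply, smul_eq_mul]
    rw [← this]
    ring
  have hsumfirst : ∀ (j : Fin n), r j = k → ∀ a, mu j ≤ a → a ≤ K →
      (∀ i : Fin n, i.val + 1 = j.val → a ≤ mu i) →
      ∑ ν ∈ Finset.Icc (mu j) a, W.rowWeight mu k j ν • C j ν = C' j (mu j) -
        (∏ c ∈ Finset.Ioc (mu j) a, (W.p k - W.α c)) • (W.p k + W.y k) • G j a := by
    intro j hj a ha haK hup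
    have h1 : Finset.Icc (mu j) a = insert (mu j) (Finset.Ioc (mu j) a) := by
      ext c; simp only [Finset.mem_Icc, Finset.mem_Ioc, Finset.mem_insert]; omega
    have h2 : ∀ ν ∈ Finset.Ioc (mu j) a, W.rowWeight mu k j ν • C j ν = (W.p k + W.y k) •
        (∏ c ∈ Finset.Ioo (mu j) ν, (W.p k - W.α c)) • C j ν := by
      intro ν hν
      rw [Finset.mem_Ioc] at hν
      rw [W.rowWeight_of_le mu k hν.1 fun i hi => hν.2.trans (hup i hi), mul_comm, mul_smul]
    rw [h1, Finset.sum_insert (by simp), W.rowWeight_self, one_smul, Finset.sum_congr rfl h2,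
      ← Finset.smul_sum, sum_Ioc_telescope (fun c => W.p k - W.α c) (C j) (G j) a
        (fun b _ => hGrel j hj b) _ ha, hC'rel j hj, smul_sub, smul_comm (W.p k + W.y k)]
    abel
  have hsumlast : ∀ i j : Fin n, i.val + 1 = j.val → mu i < lam j → r i = k → r j = k →
      ∀ b, mu i ≤ b → b ≤ K →
      ∑ ν ∈ Finset.Ioc b K, W.rowWeight mu k j ν • C j ν =
        ((∏ c ∈ Finset.Ioc (mu j) (mu i), (W.p k - W.α c)) *
          (∏ c ∈ Finset.Ioc (mu i) b, (W.β i - W.α c)) * (W.β i + W.y k)) • C i b := by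
    intro i j hij hlt hi hj b hb hbK
    have h2 : ∀ ν ∈ Finset.Ioc b K, W.rowWeight mu k j ν • C j ν =
        ((∏ c ∈ Finset.Ioc (mu j) (mu i), (W.p k - W.α c)) *
          (∏ c ∈ Finset.Ioc (mu i) b, (W.β i - W.α c)) * (W.β i + W.y k)) •
        (∏ c ∈ Finset.Ioo b ν, (W.β i - W.α c)) • C j ν := by
      intro ν hν
      rw [Finset.mem_Ioc] at hν
      rw [W.rowWeight_of_lt hmu k hij hb hν.1, mul_smul]
    rw [Finset.sum_congr rfl h2, ← Finset.smul_sum,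
      sum_Ioc_telescope (fun c => W.β i - W.α c) (C j) (C i) K
        (fun b _ => hCrel i j hij hlt hi hj b) b hbK, hCK, smul_zero, sub_zero]
  have hrk : ∀ i j : Fin n, i.val + 1 = j.val → mu i < lam j → r j = k → r i = k := by
    intro i j hij hlt hj
    have h1 := hflag i j hij hlt
    have h2 := hr i
    omega
  rw [Finset.sum_congr rfl hdet, sum_antitone_det _ _ hmu _ C, hdet']
  · -- the full sums
    have hsingle : ∀ j, r j ≠ k → ∑ ν ∈ Finset.Icc (mu j) (if r j = k then K else mu j),
        W.rowWeight mu k j ν • C j ν = C' j (mu j) := by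
      intro j hj
      simp only [if_neg hj, Finset.Icc_self, Finset.sum_singleton, W.rowWeight_self, one_smul,
        C, C', hr2 j hj]
    -- At the start of a block the terms beyond `lam j` vanish, and so does the telescoping
    -- remainder `G j (lam j)`.
    have hblock : ∀ j, (∀ i : Fin n, i.val + 1 = j.val → lam j ≤ mu i) →
        ∑ ν ∈ Finset.Icc (mu j) (if r j = k then K else mu j),
        W.rowWeight mu k j ν • C j ν = C' j (mu j) := by
      intro j hj
      by_cases hjk : r j = k
      · rw [if_pos hjk, ← Finset.sum_subset (Finset.Icc_subset_Icc_right (hlK j)) ?_,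
          hsumfirst j hjk (lam j) (hle j) (hlK j) hj, hGfirst j hj, smul_zero, smul_zero, sub_zero]
        intro ν hν hν'
        rw [Finset.mem_Icc] at hν hν'
        rw [hfirst j hj ν (by omega), smul_zero]
      · exact hsingle j hjk
    apply det_eq_of_pred
    · intro j hj
      exact hblock j fun i hi => absurd hi (by omega)
    · intro i j hij
      have huniq : ∀ i' : Fin n, i'.val + 1 = j.val → i' = i := fun i' h => Fin.ext (by omega)
      rcases le_or_gt (lam j) (mu i) with hlt | hlt
      · refine ⟨0, ?_⟩
        rw [zero_smul, add_zero]
        exact hblock j fun i' hi' => by rwa [huniq i' hi']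
      · by_cases hjk : r j = k
        · have hik := hrk i j hij hlt hjk
          have h1 : mu j ≤ mu i := hmu (Fin.le_def.2 (by omega))
          have h2 : mu i ≤ K := (hle i).trans (hlK i)
          have h3 : Finset.Icc (mu j) K = Finset.Icc (mu j) (mu i) ∪ Finset.Ioc (mu i) K := by
            ext c; simp only [Finset.mem_Icc, Finset.mem_Ioc, Finset.mem_union]; omega
          have h4 : Disjoint (Finset.Icc (mu j) (mu i)) (Finset.Ioc (mu i) K) := by
            rw [Finset.disjoint_left]
            intro c hc hc'
            rw [Finset.mem_Icc] at hc
            rw [Finset.mem_Ioc] at hc'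
            omega
          -- The range is split at `mu i`. The remainders `-(p + y) G j` and `(β + y) C i` at `mu i`
          -- add up to `(β - p) C' i`, times the weight of the columns up to `mu i`.
          refine ⟨(∏ c ∈ Finset.Ioc (mu j) (mu i), (W.p k - W.α c)) * (W.β i - W.p k), ?_⟩
          change ∑ ν ∈ Finset.Icc (mu j) (if r j = k then K else mu j),
            W.rowWeight mu k j ν • C j ν = C' j (mu j) + _ • C' i (mu i)
          rw [if_pos hjk, h3, Finset.sum_union h4, hsumfirst j hjk (mu i) h1 h2
            (fun i' hi' => by rw [huniq i' hi']), hsumlast i j hij hlt hik hjk (mu i) le_rfl h2,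
            Finset.Ioc_self, Finset.prod_empty, mul_one, mul_smul, mul_smul,
            hC'C i j hij hlt hik, smul_add]
          abel
        · refine ⟨0, ?_⟩
          rw [zero_smul, add_zero]
          exact hsingle j hjk
  · intro i j hij b hb hbK
    rcases le_or_gt (lam j) (mu i) with hlt | hlt
    · refine ⟨0, ?_⟩
      rw [zero_smul]
      refine Finset.sum_eq_zero fun ν hν => ?_
      rw [Finset.mem_Ioc] at hν
      rw [hfirst j (fun i' hi' => ?_) ν (by omega), smul_zero]
      rwa [Fin.ext (show i'.val = i.val by omega)]
    · by_cases hjk : r j = k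
      · have hik := hrk i j hij hlt hjk
        rw [if_pos hik] at hbK
        rw [if_pos hjk]
        exact ⟨_, hsumlast i j hij hlt hik hjk b hb hbK⟩
      -- Row `j` admits no letter `k`, so `ν_j = mu j ≤ mu i ≤ b` and there is nothing to sum.
      · refine ⟨0, ?_⟩
        have h1 : mu j ≤ mu i := hmu (Fin.le_def.2 (by omega))
        rw [if_neg hjk, Finset.Ioc_eq_empty (by omega), Finset.sum_empty, zero_smul]

end Weights

/-! ### Flagged fillings -/

section Fillings

variable {n : ℕ}

/-- The flagged reverse plane partitions of the skew shape with the cells `(i, c)`,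
`mu i < c ≤ lam i`. -/
structure IsFilling (lam mu r s : Fin n → ℤ) (T : Fin n → ℤ → ℤ) : Prop where
  le : mu ≤ lam
  zero : ∀ i c, ¬ (mu i < c ∧ c ≤ lam i) → T i c = 0
  flag : ∀ i c, mu i < c → c ≤ lam i → r i ≤ T i c ∧ T i c ≤ s i
  row : ∀ i c c', c ≤ c' → mu i < c → c' ≤ lam i → T i c ≤ T i c'
  col : ∀ i i' c, i ≤ i' → mu i < c → c ≤ lam i' → T i c ≤ T i' c

theorem finite_isFilling (lam mu r s : Fin n → ℤ) : {T | IsFilling lam mu r s T}.Finite := by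
  let cells : Finset (Fin n × ℤ) :=
    Finset.univ.biUnion fun i => (Finset.Ioc (mu i) (lam i)).image fun c => (i, c)
  have hcells : ∀ i c, (i, c) ∈ cells ↔ mu i < c ∧ c ≤ lam i := by
    intro i c
    simp [cells]
  let f : (Fin n → ℤ → ℤ) → cells → ℤ := fun T x => T x.1.1 x.1.2
  have hfin : (Set.Icc (fun x : cells => r x.1.1) (fun x => s x.1.1)).Finite := Set.finite_Icc _ _
  refine Set.Finite.of_finite_image (f := f) (hfin.subset ?_) ?_
  · rintro _ ⟨T, hT, rfl⟩
    refine ⟨fun x => ?_, fun x => ?_⟩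
    · have := (hcells x.1.1 x.1.2).1 x.2
      exact (hT.flag _ _ this.1 this.2).1
    · have := (hcells x.1.1 x.1.2).1 x.2
      exact (hT.flag _ _ this.1 this.2).2
  · intro T hT T' hT' hTT'
    ext i c
    by_cases hc : mu i < c ∧ c ≤ lam i
    · exact congrFun hTT' ⟨(i, c), (hcells i c).2 hc⟩
    · rw [hT.zero i c hc, hT'.zero i c hc]

theorem antitone_of_pred {ν : Fin n → ℤ} (h : ∀ i j : Fin n, i.val + 1 = j.val → ν j ≤ ν i) :
    Antitone ν := by
  have key : ∀ d : ℕ, ∀ i j : Fin n, i.val + d = j.val → ν j ≤ ν i := by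
    intro d
    induction d with
    | zero => intro i j hij; rw [Fin.ext (show i.val = j.val by omega)]
    | succ d ih =>
      intro i j hij
      exact (h ⟨i.val + d, by omega⟩ j (by simp; omega)).trans (ih i _ rfl)
  intro i j hij
  rw [Fin.le_def] at hij
  exact key (j.val - i.val) i j (by omega)

/-- The entries equal to the smallest letter fill a skew shape. -/
theorem exists_shape {lam mu r s : Fin n → ℤ} {T : Fin n → ℤ → ℤ} (hT : IsFilling lam mu r s T)
    {k : ℤ} (hr : ∀ i, k ≤ r i) :
    ∃ ν : Fin n → ℤ, ∀ i, mu i ≤ ν i ∧ ν i ≤ lam i ∧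
      ∀ c, mu i < c → c ≤ lam i → (T i c = k ↔ c ≤ ν i) := by
  have key : ∀ i, ∃ ν : ℤ, mu i ≤ ν ∧ ν ≤ lam i ∧
      ∀ c, mu i < c → c ≤ lam i → (T i c = k ↔ c ≤ ν) := by
    intro i
    have hne : ((Finset.Icc (mu i) (lam i)).filter fun c => c = mu i ∨ T i c = k).Nonempty :=
      ⟨mu i, by simp [hT.le i]⟩
    refine ⟨Finset.max' _ hne, ?_, ?_, ?_⟩
    · exact Finset.le_max' _ _ (by simp [hT.le i])
    · have := Finset.max'_mem _ hne
      rw [Finset.mem_filter, Finset.mem_Icc] at this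
      exact this.1.2
    · intro c hc hc'
      constructor
      · intro h
        exact Finset.le_max' _ _ (by simp [h, hc.le, hc'])
      · intro h
        have := Finset.max'_mem _ hne
        rw [Finset.mem_filter, Finset.mem_Icc] at this
        have h1 := hT.row i c _ h hc this.1.2
        have h2 := (hT.flag i c hc hc').1
        have h3 := hr i
        rcases this.2 with h4 | h4 <;> omega
  choose ν hν using key
  exact ⟨ν, hν⟩

end Fillings

/-! ### Generating functions of fillings and the induction on the smallest letter. -/

namespace Weights

variable {R : Type*} [CommRing R] (W : Weights R) {n : ℕ}

open Classical in
/-- The weight of a cell of a filling. -/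
noncomputable def cellWeight (lam mu : Fin n → ℤ) (T : Fin n → ℤ → ℤ) (i : Fin n) (c : ℤ) : R :=
  (if ∃ i' : Fin n, i'.val + 1 = i.val ∧ mu i' < c ∧ T i' c = T i c then W.β (i.val - 1)
    else W.p (T i c)) +
  if c < lam i ∧ T i (c + 1) = T i c then -W.α c else W.y (T i c)

/-- The weight of a filling. -/
noncomputable def weight (lam mu : Fin n → ℤ) (T : Fin n → ℤ → ℤ) : R :=
  ∏ i, ∏ c ∈ Finset.Ioc (mu i) (lam i), W.cellWeight lam mu T i c

/-- The generating function of the flagged fillings. -/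
noncomputable def genFun (lam mu r s : Fin n → ℤ) : R :=
  ∑ᶠ T ∈ {T | IsFilling lam mu r s T}, W.weight lam mu T

theorem genFun_eq_zero {lam mu r s : Fin n → ℤ} (h : ∀ T, ¬ IsFilling lam mu r s T) :
    W.genFun lam mu r s = 0 := by
  have : {T | IsFilling lam mu r s T} = ∅ := Set.eq_empty_of_forall_notMem h
  rw [genFun, this, finsum_mem_empty]

theorem genFun_self (lam r s : Fin n → ℤ) : W.genFun lam lam r s = 1 := by
  have : {T | IsFilling lam lam r s T} = {fun _ _ => 0} := by
    ext T
    rw [Set.mem_ofPred_eq, Set.mem_singleton_iff]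
    constructor
    · intro hT
      ext i c
      exact hT.zero i c (by omega)
    · rintro rfl
      exact ⟨le_rfl, fun _ _ _ => rfl, fun i c h h' => by omega, fun _ _ _ _ _ _ => le_rfl,
        fun _ _ _ _ _ _ => le_rfl⟩
  rw [genFun, this, finsum_mem_singleton]
  simp [weight]

theorem genFun_congr_flag {lam mu : Fin n → ℤ} (r s s' : Fin n → ℤ)
    (h : ∀ i, lam i = mu i ∨ s i = s' i) : W.genFun lam mu r s = W.genFun lam mu r s' := by
  have key : ∀ s s' : Fin n → ℤ, (∀ i, lam i = mu i ∨ s i = s' i) → ∀ T,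
      IsFilling lam mu r s T → IsFilling lam mu r s' T := by
    intro s s' h T hT
    refine ⟨hT.le, hT.zero, fun i c hc hc' => ?_, hT.row, hT.col⟩
    rcases h i with hi | hi
    · omega
    · rw [← hi]
      exact hT.flag i c hc hc'
  have : {T | IsFilling lam mu r s T} = {T | IsFilling lam mu r s' T} :=
    Set.ext fun T => ⟨key s s' h T, key s' s (fun i => (h i).imp_right Eq.symm) T⟩
  rw [genFun, genFun, this]

/-- For a `k`-cell, any cell of the shape directly above is again filled with `k` because `ν` is
decreasing. For the other cells, a cell above with the same entry is not filled with `k` and hence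
survives in `lam / ν`. -/
theorem weight_remove_letter {lam mu ν : Fin n → ℤ} (hlam : Antitone lam) (hν : Antitone ν)
    (hmuν : ∀ i, mu i ≤ ν i) (hνlam : ∀ i, ν i ≤ lam i) {k : ℤ} (T : Fin n → ℤ → ℤ)
    (hT : ∀ i c, mu i < c → c ≤ lam i → (T i c = k ↔ c ≤ ν i)) :
    W.weight lam mu T = (∏ j, W.rowWeight mu k j (ν j)) *
      W.weight lam ν (fun i c => if ν i < c then T i c else 0) := by
  rw [weight, weight, ← Finset.prod_mul_distrib]
  refine Finset.prod_congr rfl fun i _ => ?_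
  have h1 : Finset.Ioc (mu i) (lam i) = Finset.Ioc (mu i) (ν i) ∪ Finset.Ioc (ν i) (lam i) :=
    (Finset.Ioc_union_Ioc_eq_Ioc (hmuν i) (hνlam i)).symm
  have h2 : Disjoint (Finset.Ioc (mu i) (ν i)) (Finset.Ioc (ν i) (lam i)) := by
    rw [Finset.disjoint_left]
    intro c hc hc'
    rw [Finset.mem_Ioc] at hc hc'
    omega
  rw [h1, Finset.prod_union h2, rowWeight]
  have hanti : ∀ i' : Fin n, i'.val + 1 = i.val → i' ≤ i := fun i' h => Fin.le_def.2 (by omega)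
  congr 1
  · refine Finset.prod_congr rfl fun c hc => ?_
    rw [Finset.mem_Ioc] at hc
    have hcl := hc.2.trans (hνlam i)
    have hk := (hT i c hc.1 hcl).2 hc.2
    have e1 : (∃ i' : Fin n, i'.val + 1 = i.val ∧ mu i' < c ∧ T i' c = T i c) ↔
        ∃ i' : Fin n, i'.val + 1 = i.val ∧ mu i' < c := by
      refine exists_congr fun i' => and_congr_right fun hi' => and_iff_left_of_imp fun h => ?_
      rw [hk]
      exact (hT i' c h (hcl.trans (hlam (hanti i' hi')))).2 (hc.2.trans (hν (hanti i' hi')))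
    have e2 : (c < lam i ∧ T i (c + 1) = T i c) ↔ c < ν i := by
      rw [hk]
      constructor
      · rintro ⟨h, h'⟩
        have := (hT i (c + 1) (by omega) (by omega)).1 h'
        omega
      · intro h
        have := hνlam i
        exact ⟨by omega, (hT i (c + 1) (by omega) (by omega)).2 (by omega)⟩
    rw [hk] at e1 e2
    simp only [cellWeight, hk, e1, e2]
  · refine Finset.prod_congr rfl fun c hc => ?_
    rw [Finset.mem_Ioc] at hc
    have hmc : mu i < c := (hmuν i).trans_lt hc.1
    have hk : T i c ≠ k := fun h => by
      have := (hT i c hmc hc.2).1 h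
      omega
    have e1 : (∃ i' : Fin n, i'.val + 1 = i.val ∧ mu i' < c ∧ T i' c = T i c) ↔
        ∃ i' : Fin n, i'.val + 1 = i.val ∧ ν i' < c ∧ (if ν i' < c then T i' c else 0) = T i c := by
      refine exists_congr fun i' => and_congr_right fun hi' => ?_
      constructor
      · rintro ⟨h, h'⟩
        have h3 : ν i' < c := by
          by_contra hle
          exact hk (h' ▸ (hT i' c h (hc.2.trans (hlam (hanti i' hi')))).2 (not_lt.1 hle))
        exact ⟨h3, by rwa [if_pos h3]⟩
      · rintro ⟨h, h'⟩
        rw [if_pos h] at h'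
        exact ⟨(hmuν i').trans_lt h, h'⟩
    have h5 : ν i < c + 1 := by omega
    simp only [cellWeight, e1, if_pos hc.1, if_pos h5]

/-- Fillings are grouped by the shape of their `k`-cells; erasing these cells and filling them in
again are inverse bijections. Shapes `ν` in the box that are not contained in `lam` contribute zero.
-/
theorem genFun_remove_letter {lam mu : Fin n → ℤ} (hlam : Antitone lam) (hmu : Antitone mu)
    (r s : Fin n → ℤ) {k K : ℤ} (hK : ∀ i, lam i ≤ K) (hr : ∀ j, k ≤ r j)
    (hs : ∀ i, k ≤ s i) :
    W.genFun lam mu r s = ∑ ν ∈ Fintype.piFinset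
        (fun j : Fin n => Finset.Icc (mu j) (if r j = k then K else mu j)) with
        ∀ i j : Fin n, i.val + 1 = j.val → ν j ≤ ν i,
      (∏ j, W.rowWeight mu k j (ν j)) * W.genFun lam ν (fun j => max (r j) (k + 1)) s := by
  classical
  have hex : ∀ T, ∃ ν : Fin n → ℤ, IsFilling lam mu r s T → ∀ i, mu i ≤ ν i ∧ ν i ≤ lam i ∧
      ∀ c, mu i < c → c ≤ lam i → (T i c = k ↔ c ≤ ν i) := by
    intro T
    by_cases hT : IsFilling lam mu r s T
    · obtain ⟨ν, hν⟩ := exists_shape hT hr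
      exact ⟨ν, fun _ => hν⟩
    · exact ⟨0, fun h => absurd h hT⟩
  choose shape hshape using hex
  rw [genFun, finsum_mem_eq_finite_toFinset_sum _ (finite_isFilling lam mu r s),
    ← Finset.sum_fiberwise_of_maps_to (g := shape)]
  · refine Finset.sum_congr rfl fun ν hν => ?_
    rw [Finset.mem_filter, Fintype.mem_piFinset] at hν
    obtain ⟨hbox, hanti⟩ := hν
    replace hanti := antitone_of_pred hanti
    have hmuν : ∀ j, mu j ≤ ν j := fun j => (Finset.mem_Icc.1 (hbox j)).1
    rw [genFun, finsum_mem_eq_finite_toFinset_sum _ (finite_isFilling lam ν _ s),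
      Finset.mul_sum]
    refine Finset.sum_bij' (fun T _ i c => if ν i < c then T i c else 0)
      (fun T _ i c => if mu i < c ∧ c ≤ ν i then k else T i c) ?_ ?_ ?_ ?_ ?_
    · intro T hT
      rw [Finset.mem_filter, Set.Finite.mem_toFinset] at hT
      obtain ⟨hT, rfl⟩ := hT
      have hsh := hshape T hT
      rw [Set.Finite.mem_toFinset]
      refine ⟨fun i => (hsh i).2.1, fun i c hc => ?_, fun i c hc hc' => ?_,
        fun i c c' hcc' hc hc' => ?_, fun i i' c hii' hc hc' => ?_⟩
      · rw [ite_eq_right_iff]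
        intro h
        exact hT.zero i c fun h' => hc ⟨h, h'.2⟩
      · rw [if_pos hc]
        have h1 := (hsh i).1
        have h2 := hT.flag i c (by omega) hc'
        have h3 : T i c ≠ k := fun h => by
          have := ((hsh i).2.2 c (by omega) hc').1 h
          omega
        have h4 := hr i
        exact ⟨max_le h2.1 (by omega), h2.2⟩
      · rw [if_pos hc, if_pos (by omega)]
        have h1 := (hsh i).1
        exact hT.row i c c' hcc' (by omega) hc'
      · have h1 := (hsh i).1
        have h2 := hanti hii'
        rw [if_pos hc, if_pos (by omega)]
        exact hT.col i i' c hii' (by omega) hc'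
    · intro T hT
      rw [Set.Finite.mem_toFinset] at hT
      have hνlam : ∀ i, ν i ≤ lam i := hT.le
      have hgt : ∀ i c, ν i < c → c ≤ lam i → k + 1 ≤ T i c ∧ r i ≤ T i c := fun i c hc hc' =>
        ⟨(le_max_right _ _).trans (hT.flag i c hc hc').1,
          (le_max_left _ _).trans (hT.flag i c hc hc').1⟩
      have hfill : IsFilling lam mu r s (fun i c => if mu i < c ∧ c ≤ ν i then k else T i c) := by
        refine ⟨fun i => (hmuν i).trans (hνlam i), fun i c hc => ?_, fun i c hc hc' => ?_,
          fun i c c' hcc' hc hc' => ?_, fun i i' c hii' hc hc' => ?_⟩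
        · have h1 := hνlam i
          have h2 := hmuν i
          rw [if_neg (by omega)]
          exact hT.zero i c (by omega)
        · split_ifs with h
          · have h1 := Finset.mem_Icc.1 (hbox i)
            refine ⟨?_, hs i⟩
            by_contra hlt
            rw [if_neg (by omega)] at h1
            omega
          · exact ⟨(hgt i c (by omega) hc').2, (hT.flag i c (by omega) hc').2⟩
        · split_ifs with h h' h'
          · exact le_rfl
          · have := hgt i c' (by omega) hc'
            omega
          · omega
          · exact hT.row i c c' hcc' (by omega) hc'
        · have h1 := hanti hii'
          split_ifs with h h' h'
          · exact le_rfl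
          · by_cases h2 : ν i' < c
            · have := hgt i' c h2 hc'
              omega
            · have h3 := hmuν i'
              have h4 := Finset.mem_Icc.1 (hbox i')
              have h5 := hmu hii'
              omega
          · omega
          · exact hT.col i i' c hii' (by omega) hc'
      rw [Finset.mem_filter, Set.Finite.mem_toFinset]
      refine ⟨hfill, ?_⟩
      have hsh := hshape _ hfill
      ext i
      have hiff : ∀ c, mu i < c → c ≤ lam i → (c ≤ ν i ↔
          c ≤ shape (fun i c => if mu i < c ∧ c ≤ ν i then k else T i c) i) := by
        intro c hc hc'
        rw [← (hsh i).2.2 c hc hc']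
        constructor
        · intro h
          rw [if_pos ⟨hc, h⟩]
        · intro h
          by_contra hlt
          rw [if_neg (by omega)] at h
          have := hgt i c (by omega) hc'
          omega
      obtain ⟨h1, h2, -⟩ := hsh i
      have h3 := hmuν i
      have h4 := hνlam i
      generalize shape (fun i c => if mu i < c ∧ c ≤ ν i then k else T i c) i = z at *
      rcases lt_trichotomy z (ν i) with h | h | h
      · have := (hiff (ν i) (by omega) (by omega)).1 le_rfl
        omega
      · exact h
      · have := (hiff z (by omega) (by omega)).2 le_rfl
        omega
    · intro T hT
      rw [Finset.mem_filter, Set.Finite.mem_toFinset] at hT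
      obtain ⟨hT, rfl⟩ := hT
      have hsh := hshape T hT
      ext i c
      obtain ⟨h1, h2, h3⟩ := hsh i
      dsimp only
      split_ifs with h h'
      · exact ((h3 c h.1 (by omega)).2 h.2).symm
      · rfl
      · exact (hT.zero i c (by omega)).symm
    · intro T hT
      rw [Set.Finite.mem_toFinset] at hT
      ext i c
      dsimp only
      split_ifs with h h'
      · omega
      · rfl
      · exact (hT.zero i c (by omega)).symm
    · intro T hT
      rw [Finset.mem_filter, Set.Finite.mem_toFinset] at hT
      obtain ⟨hT, rfl⟩ := hT
      have hsh := hshape T hT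
      exact W.weight_remove_letter hlam hanti hmuν (fun i => (hsh i).2.1) T
        fun i => (hsh i).2.2
  · intro T hT
    rw [Set.Finite.mem_toFinset] at hT
    have hsh := hshape T hT
    rw [Finset.mem_filter, Fintype.mem_piFinset]
    refine ⟨fun j => ?_, fun i j hij => ?_⟩
    · obtain ⟨h1, h2, h3⟩ := hsh j
      rw [Finset.mem_Icc]
      refine ⟨h1, ?_⟩
      split_ifs with hj
      · exact h2.trans (hK j)
      · by_contra hlt
        have h4 := (h3 (shape T j) (by omega) h2).2 le_rfl
        have h5 := (hT.flag j (shape T j) (by omega) h2).1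
        have h6 := hr j
        omega
    · by_contra hlt
      obtain ⟨h1, h2, h3⟩ := hsh j
      obtain ⟨h1', h2', h3'⟩ := hsh i
      have hle : i ≤ j := Fin.le_def.2 (by omega)
      have h7 := hlam hle
      by_cases h0 : mu j < shape T j
      · have h4 := (h3 (shape T j) h0 h2).2 le_rfl
        have h5 := hT.col i j (shape T j) hle (by omega) h2
        have h6 := (hT.flag i (shape T j) (by omega) (by omega)).1
        have h8 := hr i
        have := (h3' (shape T j) (by omega) (by omega)).1 (by omega)
        omega
      · have := hmu hle
        omega

theorem genFun_eq_jtDet_of_lt {lam mu : Fin n → ℤ} (hlam : Antitone lam) (hmu : Antitone mu)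
    (r s : Fin n → ℤ) (h : ∀ i, mu i < lam i → s i < r i)
    (hzero : (∃ i, mu i < lam i) → W.jtDet lam mu r s = 0) :
    W.genFun lam mu r s = W.jtDet lam mu r s := by
  by_cases hle : mu ≤ lam
  · by_cases hempty : ∃ i, mu i < lam i
    · rw [hzero hempty]
      obtain ⟨i, hi⟩ := hempty
      refine W.genFun_eq_zero fun T hT => ?_
      have h1 := hT.flag i (lam i) hi le_rfl
      have h2 := h i hi
      omega
    · push Not at hempty
      have : mu = lam := le_antisymm hle hempty
      rw [this, W.genFun_self, W.jtDet_self hlam]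
  · rw [W.jtDet_eq_zero_of_not_le hlam hmu r s hle]
    exact W.genFun_eq_zero fun T hT => hle hT.le

/-- The generating function of the flagged fillings is the Jacobi-Trudi determinant. -/
theorem genFun_eq_jtDet {lam mu : Fin n → ℤ} (hlam : Antitone lam) (hmu : Antitone mu)
    (r s : Fin n → ℤ) (hr : ∀ i j : Fin n, i.val + 1 = j.val → mu i < lam j → r i ≤ r j)
    (hs : ∀ i j : Fin n, i.val + 1 = j.val → mu i < lam j → s i ≤ s j) :
    W.genFun lam mu r s = W.jtDet lam mu r s := by
  obtain ⟨N, hN⟩ : ∃ N, ∀ i, s i ≤ N := by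
    obtain ⟨N, hN⟩ := (Set.finite_range s).bddAbove
    exact ⟨N, fun i => hN ⟨i, rfl⟩⟩
  obtain ⟨K, hK⟩ : ∃ K, ∀ i, lam i + n ≤ K := by
    obtain ⟨K, hK⟩ := (Set.finite_range fun i => lam i + n).bddAbove
    exact ⟨K, fun i => hK ⟨i, rfl⟩⟩
  obtain ⟨k, hk⟩ : ∃ k, ∀ i, k ≤ r i := by
    obtain ⟨k, hk⟩ := (Set.finite_range r).bddBelow
    exact ⟨k, fun i => hk ⟨i, rfl⟩⟩
  obtain ⟨d, hd⟩ : ∃ d : ℕ, N < k + d := ⟨(N + 1 - k).toNat, by omega⟩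
  -- The number `d` bounds how many letters from `k` upwards can still occur; at `d = 0` every upper
  -- flag lies below `k`.
  induction d generalizing k mu r s with
  | zero =>
    have hlt : ∀ i, s i < k := fun i => by have := hN i; simp at hd; omega
    exact W.genFun_eq_jtDet_of_lt hlam hmu r s (fun i _ => (hlt i).trans_le (hk i))
      fun ⟨i, hi⟩ => W.jtDet_eq_zero_of_empty_flag hlam hmu r s hk hs ⟨i, hi, hlt i⟩
  | succ d ih =>
    by_cases hle : mu ≤ lam
    · by_cases hempty : ∃ i, mu i < lam i ∧ s i < k
      · rw [W.jtDet_eq_zero_of_empty_flag hlam hmu r s hk hs hempty]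
        obtain ⟨i, hi, hik⟩ := hempty
        refine W.genFun_eq_zero fun T hT => ?_
        have h1 := hT.flag i (lam i) hi le_rfl
        have h2 := hk i
        omega
      · push Not at hempty
        -- Raising the upper flags of empty rows to `k` changes neither side and makes `k ≤ s i`
        -- hold in every row, as removing the letter requires.
        have h1 : ∀ i, lam i = mu i ∨ s i = max (s i) k := by
          intro i
          rcases (hle i).eq_or_lt with h | h
          · exact Or.inl h.symm
          · exact Or.inr (max_eq_left (hempty i h)).symm
        rcases lt_or_ge N k with hNk | hNk
        · have hlt : ∀ i, s i < k := fun i => (hN i).trans_lt hNk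
          exact W.genFun_eq_jtDet_of_lt hlam hmu r s (fun i _ => (hlt i).trans_le (hk i))
            fun ⟨i, hi⟩ => W.jtDet_eq_zero_of_empty_flag hlam hmu r s hk hs ⟨i, hi, hlt i⟩
        · rw [W.genFun_congr_flag r s _ h1, W.jtDet_congr_flag hlam hmu r s _ h1,
            W.genFun_remove_letter hlam hmu r _ (fun i => (by have := hK i; omega : lam i ≤ K)) hk
              fun i => le_max_right _ _,
            ← W.jtDet_remove_letter hlam hmu hle r _ hK hk (fun i => le_max_right _ _) hr]
          refine Finset.sum_congr rfl fun ν hν => ?_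
          rw [Finset.mem_filter, Fintype.mem_piFinset] at hν
          have hmuν : ∀ j, mu j ≤ ν j := fun j => (Finset.mem_Icc.1 (hν.1 j)).1
          rw [ih (antitone_of_pred hν.2) _ _ ?_ ?_ ?_ (k := k + 1) ?_ ?_]
          · intro i j hij hlt
            exact max_le_max_right _ (hr i j hij ((hmuν i).trans_lt hlt))
          · intro i j hij hlt
            exact max_le_max_right _ (hs i j hij ((hmuν i).trans_lt hlt))
          · exact fun i => max_le (hN i) hNk
          · exact fun i => le_max_right _ _
          · push_cast at hd
            omega
    · rw [W.jtDet_eq_zero_of_not_le hlam hmu r s hle]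
      exact W.genFun_eq_zero fun T hT => hle hT.le

end Weights

/-! ### Reverse plane partitions without marks -/

theorem mem_skew {lam mu : YoungDiagram} {i j : ℕ} :
    (i, j) ∈ skew lam mu ↔ mu.rowLen i ≤ j ∧ j < lam.rowLen i := by
  rw [skew, Finset.mem_sdiff, YoungDiagram.mem_cells, YoungDiagram.mem_cells,
    YoungDiagram.mem_iff_lt_rowLen, YoungDiagram.mem_iff_lt_rowLen, not_lt, and_comm]

theorem mem_skew_transpose {lam mu : YoungDiagram} {i j : ℕ} :
    (i, j) ∈ skew lam.transpose mu.transpose ↔ mu.rowLen j ≤ i ∧ i < lam.rowLen j := by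
  rw [← mem_skew]
  simp [skew, YoungDiagram.mem_transpose]

/-- The reverse plane partitions of a skew shape, extended by zeros. -/
structure IsRPP (lam mu : YoungDiagram) (E : ℕ → ℕ → ℕ) : Prop where
  subset : mu ≤ lam
  pos : ∀ i j, (i, j) ∈ skew lam mu → 0 < E i j
  zeros : ∀ i j, (i, j) ∉ skew lam mu → E i j = 0
  row_weak : ∀ i j j', j ≤ j' → (i, j) ∈ skew lam mu → (i, j') ∈ skew lam mu → E i j ≤ E i j'
  col_weak : ∀ i i' j, i ≤ i' → (i, j) ∈ skew lam mu → (i', j) ∈ skew lam mu → E i j ≤ E i' j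

open Classical in
/-- The weight of an unmarked cell. -/
noncomputable def plainWeight (lam mu : YoungDiagram) (E : ℕ → ℕ → ℕ) (i j : ℕ) : Poly :=
  if 1 ≤ i ∧ (i - 1, j) ∈ skew lam mu ∧ E i j = E (i - 1) j then MvPolynomial.X (Var.β i)
  else MvPolynomial.X (Var.x (E i j))

open Classical in
/-- The sum of the weights of a cell over all its possible markings. -/
noncomputable def rppWeight (lam mu : YoungDiagram) (E : ℕ → ℕ → ℕ) (i j : ℕ) : Poly :=
  (if (i, j + 1) ∈ skew lam mu ∧ E i j = E i (j + 1) then -MvPolynomial.X (Var.α (j + 1)) else 0) +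
    plainWeight lam mu E i j

/-- Expanding the product of the cell sums yields one term per set of marked cells; a set containing
a cell that may not be marked contributes zero. -/
theorem sum_wt_of_entry_eq {lam mu : YoungDiagram} {E : ℕ → ℕ → ℕ} (hE : IsRPP lam mu E)
    (S : Finset (MRPP lam mu)) (hS : ∀ T : MRPP lam mu, T ∈ S ↔ T.entry = E) :
    ∑ T ∈ S, T.wt = ∏ c ∈ skew lam mu, rppWeight lam mu E c.1 c.2 := by
  classical
  simp only [rppWeight]
  rw [Finset.prod_add, ← Finset.sum_subset
    (Finset.powerset_mono.2 (Finset.filter_subset (fun c =>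
      (c.1, c.2 + 1) ∈ skew lam mu ∧ E c.1 c.2 = E c.1 (c.2 + 1)) (skew lam mu)))]
  · refine Finset.sum_bij' (fun T _ => T.marked)
      (fun t ht => ⟨E, t, hE.subset, hE.pos, hE.zeros, hE.row_weak, hE.col_weak, fun i j hij => by
        have := Finset.mem_powerset.1 ht hij
        exact Finset.mem_filter.1 this⟩) ?_ ?_ ?_ ?_ ?_
    · intro T hT
      rw [hS] at hT
      rw [Finset.mem_powerset]
      rintro ⟨i, j⟩ hij
      rw [Finset.mem_filter, ← hT]
      exact T.marked_spec i j hij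
    · intro t ht
      rw [hS]
    · intro T hT
      rw [hS] at hT
      exact MRPP.ext hT.symm rfl
    · intro t ht
      rfl
    · intro T hT
      rw [hS] at hT
      subst hT
      have hsub : T.marked ⊆ skew lam mu := fun c hc => (T.marked_spec c.1 c.2 hc).1
      rw [MRPP.wt, ← Finset.prod_sdiff hsub, mul_comm]
      congr 1
      · refine Finset.prod_congr rfl fun c hc => ?_
        rw [MRPP.cellWt, if_pos hc, if_pos (T.marked_spec c.1 c.2 hc).2]
      · refine Finset.prod_congr rfl fun c hc => ?_
        rw [MRPP.cellWt, if_neg (Finset.mem_sdiff.1 hc).2, plainWeight]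
  · intro t ht hnot
    rw [Finset.mem_powerset] at ht hnot
    obtain ⟨c, hct, hc⟩ := Finset.not_subset.1 hnot
    rw [Finset.prod_eq_zero hct, zero_mul]
    exact if_neg fun h => hc (Finset.mem_filter.2 ⟨ht hct, h⟩)

theorem finsum_mrpp {lam mu : YoungDiagram} (Q : (ℕ → ℕ → ℕ) → Prop)
    (hfin : {T : MRPP lam mu | Q T.entry}.Finite) :
    ∑ᶠ T ∈ {T : MRPP lam mu | Q T.entry}, T.wt =
      ∑ᶠ E ∈ {E | IsRPP lam mu E ∧ Q E}, ∏ c ∈ skew lam mu, rppWeight lam mu E c.1 c.2 := by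
  classical
  have himg : {E | IsRPP lam mu E ∧ Q E} = MRPP.entry '' {T : MRPP lam mu | Q T.entry} := by
    ext E
    constructor
    · rintro ⟨hE, hQ⟩
      exact ⟨⟨E, ∅, hE.subset, hE.pos, hE.zeros, hE.row_weak, hE.col_weak, by simp⟩, hQ, rfl⟩
    · rintro ⟨T, hT, rfl⟩
      exact ⟨⟨T.subset, T.pos, T.zeros, T.row_weak, T.col_weak⟩, hT⟩
  have hfin' : {E | IsRPP lam mu E ∧ Q E}.Finite := himg ▸ hfin.image _
  rw [finsum_mem_eq_finite_toFinset_sum _ hfin, finsum_mem_eq_finite_toFinset_sum _ hfin',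
    ← Finset.sum_fiberwise_of_maps_to (g := MRPP.entry) (t := hfin'.toFinset)]
  · refine Finset.sum_congr rfl fun E hE => ?_
    rw [Set.Finite.mem_toFinset] at hE
    refine sum_wt_of_entry_eq hE.1 _ fun T => ?_
    rw [Finset.mem_filter, Set.Finite.mem_toFinset]
    refine ⟨fun h => h.2, fun h => ⟨?_, h⟩⟩
    change Q T.entry
    rw [h]
    exact hE.2
  · intro T hT
    rw [Set.Finite.mem_toFinset] at hT ⊢
    rw [himg]
    exact ⟨T, hT, rfl⟩

theorem youngDiagram_le_iff {lam mu : YoungDiagram} {n : ℕ} (hmu : mu.colLen 0 ≤ n) :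
    mu ≤ lam ↔ ∀ i : Fin n, mu.rowLen i ≤ lam.rowLen i := by
  constructor
  · intro h i
    by_contra! hlt
    have h1 : (i.val, lam.rowLen i) ∈ mu := YoungDiagram.mem_iff_lt_rowLen.2 hlt
    have h2 : (i.val, lam.rowLen i) ∈ lam := h h1
    exact lt_irrefl _ (YoungDiagram.mem_iff_lt_rowLen.1 h2)
  · rintro h ⟨i, j⟩ hij
    have hij' : (i, j) ∈ mu := hij
    have hi : i < n := (YoungDiagram.mem_iff_lt_colLen.1
      (mu.up_left_mem le_rfl (Nat.zero_le j) hij')).trans_le hmu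
    exact YoungDiagram.mem_iff_lt_rowLen.2
      ((YoungDiagram.mem_iff_lt_rowLen.1 hij').trans_le (h ⟨i, hi⟩))

theorem lt_of_lt_rowLen {lam : YoungDiagram} {n : ℕ} (hlam : lam.colLen 0 ≤ n) {i j : ℕ}
    (h : j < lam.rowLen i) : i < n :=
  (YoungDiagram.mem_iff_lt_colLen.1 (lam.up_left_mem le_rfl (Nat.zero_le j)
    (YoungDiagram.mem_iff_lt_rowLen.2 h))).trans_le hlam

/-! ### The parameters of the row and column versions -/

theorem hUnit_eq (v : Var) : hUnit v = (linUnit (MvPolynomial.X v : Poly))⁻¹ := by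
  rw [eq_inv_iff_mul_eq_one]
  ext : 1
  exact (hUnit v).val_inv

theorem eUnit_eq (v : Var) : eUnit v = linUnit (-MvPolynomial.X v : Poly) := by
  ext : 1
  simp [eUnit, val_linUnit]

theorem hSeries_zero : hSeries 0 = 1 := Finsupp.prod_zero_index

theorem eSeries_zero : eSeries 0 = 1 := Finsupp.prod_zero_index

theorem hSeries_neg (Z : Alphabet) : hSeries (-Z) = (hSeries Z)⁻¹ := by
  rw [eq_inv_iff_mul_eq_one, ← hSeries_add, neg_add_cancel, hSeries_zero]

theorem eSeries_neg (Z : Alphabet) : eSeries (-Z) = (eSeries Z)⁻¹ := by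
  rw [eq_inv_iff_mul_eq_one, ← eSeries_add, neg_add_cancel, eSeries_zero]

theorem hSeries_sub (Y Z : Alphabet) : hSeries (Y - Z) = hSeries Y * (hSeries Z)⁻¹ := by
  rw [sub_eq_add_neg, hSeries_add, hSeries_neg]

theorem eSeries_sub (Y Z : Alphabet) : eSeries (Y - Z) = eSeries Y * (eSeries Z)⁻¹ := by
  rw [sub_eq_add_neg, eSeries_add, eSeries_neg]

theorem hSeries_single (v : Var) :
    hSeries (Finsupp.single v 1) = (linUnit (MvPolynomial.X v : Poly))⁻¹ := by
  simp [hSeries, hUnit_eq]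

theorem eSeries_single (v : Var) :
    eSeries (Finsupp.single v 1) = linUnit (-MvPolynomial.X v : Poly) := by
  simp [eSeries, eUnit_eq]

theorem hSeries_Xint (a b : ℕ) : hSeries (Xint a b) =
    ∏ k ∈ Finset.Icc a b, (linUnit (MvPolynomial.X (Var.x k) : Poly))⁻¹ := by
  rw [Xint]
  induction Finset.Icc a b using Finset.induction_on with
  | empty => simp [hSeries_zero]
  | insert k t hk ih => rw [Finset.sum_insert hk, Finset.prod_insert hk, hSeries_add, ih,
      hSeries_single]

theorem eSeries_Xint (a b : ℕ) : eSeries (Xint a b) =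
    ∏ k ∈ Finset.Icc a b, linUnit (-MvPolynomial.X (Var.x k) : Poly) := by
  rw [Xint]
  induction Finset.Icc a b using Finset.induction_on with
  | empty => simp [eSeries_zero]
  | insert k t hk ih => rw [Finset.sum_insert hk, Finset.prod_insert hk, eSeries_add, ih,
      eSeries_single]

theorem A_succ (k : ℕ) : A (k + 1) = A k + Finsupp.single (Var.α (k + 1)) 1 :=
  Finset.sum_Icc_succ_top (by omega) _

theorem B_succ (k : ℕ) : B (k + 1) = B k + Finsupp.single (Var.β (k + 1)) 1 :=
  Finset.sum_Icc_succ_top (by omega) _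

/-- The parameters of the row version: all letters are bosonic. -/
noncomputable def rowWeights : Weights Poly where
  α c := if 0 < c then MvPolynomial.X (Var.α c.toNat) else 0
  β i := MvPolynomial.X (Var.β (i + 1))
  p k := MvPolynomial.X (Var.x k.toNat)
  y _ := 0
  𝒜 c := hSeries (-A c.toNat)
  ℬ i := hSeries (-B i)
  𝒜_succ c := by
    rcases lt_or_ge c 0 with hc | hc
    · rw [if_neg (by omega), linUnit_zero, show (c + 1).toNat = c.toNat by omega, mul_one]
    · rw [if_pos (by omega), show (c + 1).toNat = c.toNat + 1 by omega, A_succ, neg_add,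
        hSeries_add, hSeries_neg (Finsupp.single _ _), hSeries_single, inv_inv]
  ℬ_succ i := by
    rw [B_succ, neg_add, hSeries_add, hSeries_neg (Finsupp.single _ _), hSeries_single, inv_inv]

/-- The parameters of the column version, for the shape rotated by a half-turn: all letters are
fermionic. -/
noncomputable def colWeights (n : ℕ) : Weights Poly where
  α c := if c < 0 then -MvPolynomial.X (Var.β (-c).toNat) else 0
  β i := if i + 1 < n then -MvPolynomial.X (Var.α (n - 1 - i)) else 0
  p _ := 0
  y k := MvPolynomial.X (Var.x (-k).toNat)
  𝒜 c := eSeries (-B (-c - 1).toNat)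
  ℬ i := eSeries (-A (n - 1 - i))
  𝒜_succ c := by
    rcases lt_or_ge (c + 1) 0 with hc | hc
    · rw [if_pos hc, show (-c - 1).toNat = (-(c + 1) - 1).toNat + 1 by omega, B_succ, neg_add (B _),
        eSeries_add, eSeries_neg (Finsupp.single _ _), eSeries_single,
        show (-(c + 1) - 1).toNat + 1 = (-(c + 1)).toNat by omega, inv_mul_cancel_right]
    · rw [if_neg (by omega), linUnit_zero, mul_one,
        show (-(c + 1) - 1).toNat = (-c - 1).toNat by omega]
  ℬ_succ i := by
    by_cases hi : i + 1 < n
    · rw [if_pos hi, show n - 1 - i = n - 1 - (i + 1) + 1 by omega, A_succ, neg_add,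
        eSeries_add, eSeries_neg (Finsupp.single _ _), eSeries_single, inv_mul_cancel_right]
    · rw [if_neg hi, linUnit_zero, mul_one, show n - 1 - (i + 1) = n - 1 - i by omega]

theorem rowWeights_entry (a b l m i j : ℕ) :
    rowWeights.entry a b l m i j =
      h ((l : ℤ) - m - i + j) (Xint a b - A (l - 1) + A m + B i - B j) := by
  rw [Weights.entry, h, coeffZ]
  congr 3
  rw [hSeries_sub, hSeries_add, hSeries_add, hSeries_sub, hSeries_Xint, Weights.series]
  have h1 : ∏ k ∈ Finset.Icc (a : ℤ) b, rowWeights.letter k =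
      ∏ k ∈ Finset.Icc a b, (linUnit (MvPolynomial.X (Var.x k) : Poly))⁻¹ := by
    symm
    refine Finset.prod_bij' (fun k _ => (k : ℤ)) (fun k _ => k.toNat) ?_ ?_ ?_ ?_ ?_
    · intro k hk
      rw [Finset.mem_Icc] at hk ⊢
      omega
    · intro k hk
      rw [Finset.mem_Icc] at hk ⊢
      omega
    · intro k hk
      omega
    · intro k hk
      rw [Finset.mem_Icc] at hk
      omega
    · intro k hk
      simp [Weights.letter, rowWeights, linUnit_zero]
  have h2 : ((l : ℤ) - 1).toNat = l - 1 := by omega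
  rw [h1]
  simp only [rowWeights, hSeries_neg, inv_inv, h2, Int.toNat_natCast]
  rw [mul_assoc _ (hSeries (B j))⁻¹, mul_comm (hSeries (B j))⁻¹, ← mul_assoc]

/-- Reflection reverses the rows and exchanges the negated row lengths of `lam` and `mu`, so both
pairs of arguments appear swapped. -/
theorem colWeights_entry {n : ℕ} (a b l m : ℕ) (i j : Fin n) :
    (colWeights n).entry (-(b : ℤ)) (-(a : ℤ)) (-(m : ℤ)) (-(l : ℤ)) j.rev i.rev =
      e ((l : ℤ) - m - i + j) (Xint a b - A i + A j + B (l - 1) - B m) := by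
  have h0 : -(m : ℤ) - -(l : ℤ) - (j.rev : ℕ) + (i.rev : ℕ) = (l : ℤ) - m - i + j := by
    rw [Fin.val_rev, Fin.val_rev]
    omega
  rw [Weights.entry, e, coeffZ, h0]
  congr 3
  rw [eSeries_sub, eSeries_add, eSeries_add, eSeries_sub, eSeries_Xint, Weights.series]
  have h1 : ∏ k ∈ Finset.Icc (-(b : ℤ)) (-(a : ℤ)), (colWeights n).letter k =
      ∏ k ∈ Finset.Icc a b, linUnit (-MvPolynomial.X (Var.x k) : Poly) := by
    symm
    refine Finset.prod_bij' (fun k _ => -(k : ℤ)) (fun k _ => (-k).toNat) ?_ ?_ ?_ ?_ ?_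
    · intro k hk
      rw [Finset.mem_Icc] at hk ⊢
      omega
    · intro k hk
      rw [Finset.mem_Icc] at hk ⊢
      omega
    · intro k hk
      omega
    · intro k hk
      rw [Finset.mem_Icc] at hk
      omega
    · intro k hk
      simp [Weights.letter, colWeights, linUnit_zero]
  have h2 : (-(-(m : ℤ) - 1) - 1).toNat = m := by omega
  have h3 : (-(-(l : ℤ)) - 1).toNat = l - 1 := by omega
  have h4 : n - 1 - (i.rev : ℕ) = i := by rw [Fin.val_rev]; omega
  have h5 : n - 1 - (j.rev : ℕ) = j := by rw [Fin.val_rev]; omega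
  rw [h1]
  simp only [colWeights, eSeries_neg, inv_inv, h2, h3, h4, h5]
  generalize (eSeries (A i))⁻¹ = u1
  generalize eSeries (A j) = u2
  generalize (eSeries (B m))⁻¹ = u3
  generalize eSeries (B (l - 1)) = u4
  generalize (∏ k ∈ Finset.Icc a b, linUnit (-MvPolynomial.X (Var.x k) : Poly)) = u5
  ext : 1
  push_cast
  ring

/-! ### The row version -/

section Row

variable {lam mu : YoungDiagram} {n : ℕ}

theorem rppWeight_eq_row {E : ℕ → ℕ → ℕ} {T : Fin n → ℤ → ℤ}
    (hT : ∀ (i : Fin n) (j : ℕ), (i.val, j) ∈ skew lam mu → T i (j + 1) = E i j)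
    (i : Fin n) (j : ℕ) (hij : (i.val, j) ∈ skew lam mu) :
    rppWeight lam mu E i j = rowWeights.cellWeight (fun i => (lam.rowLen i : ℤ))
      (fun i => (mu.rowLen i : ℤ)) T i (j + 1) := by
  have hcell := mem_skew.1 hij
  have e1 : (∃ i' : Fin n, i'.val + 1 = i.val ∧ (mu.rowLen i' : ℤ) < j + 1 ∧
      T i' (j + 1) = T i (j + 1)) ↔
      1 ≤ i.val ∧ (i.val - 1, j) ∈ skew lam mu ∧ E i j = E (i.val - 1) j := by
    constructor
    · rintro ⟨i', hi', hlt, heq⟩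
      have h1 : i.val - 1 = i'.val := by omega
      have h2 := lam.rowLen_anti i'.val i.val (by omega)
      have h3 : (i'.val, j) ∈ skew lam mu := mem_skew.2 (by omega)
      rw [hT i j hij, hT i' j h3] at heq
      rw [h1]
      exact ⟨by omega, h3, by omega⟩
    · rintro ⟨h1, h2, h3⟩
      have hmem := mem_skew.1 h2
      refine ⟨⟨i.val - 1, by omega⟩, by simp; omega, by simp; omega, ?_⟩
      rw [hT i j hij, hT _ j h2, h3]
  have e2 : ((j : ℤ) + 1 < lam.rowLen i ∧ T i (j + 1 + 1) = T i (j + 1)) ↔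
      (i.val, j + 1) ∈ skew lam mu ∧ E i j = E i (j + 1) := by
    have h1 : (i.val, j + 1) ∈ skew lam mu ↔ (j : ℤ) + 1 < lam.rowLen i := by
      rw [mem_skew]
      omega
    rw [h1]
    refine and_congr_right fun h => ?_
    have h2 := hT i (j + 1) (h1.2 h)
    push_cast at h2
    rw [h2, hT i j hij]
    omega
  rw [rppWeight, plainWeight, Weights.cellWeight, add_comm]
  rw [hT i j hij] at e1 e2
  simp only [e1, e2, hT i j hij]
  congr 1
  · split_ifs with h
    · simp [rowWeights, Nat.sub_add_cancel h.1]
    · simp [rowWeights]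
  · have h3 : (0 : ℤ) < (j : ℤ) + 1 := by omega
    have h4 : ((j : ℤ) + 1).toNat = j + 1 := by omega
    simp [rowWeights, h3, h4]

theorem prod_rppWeight_eq_row (hlam : lam.colLen 0 ≤ n) {E : ℕ → ℕ → ℕ} {T : Fin n → ℤ → ℤ}
    (hT : ∀ (i : Fin n) (j : ℕ), (i.val, j) ∈ skew lam mu → T i (j + 1) = E i j) :
    ∏ c ∈ skew lam mu, rppWeight lam mu E c.1 c.2 =
      rowWeights.weight (fun i : Fin n => (lam.rowLen i : ℤ)) (fun i => (mu.rowLen i : ℤ)) T := by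
  rw [Weights.weight, Finset.prod_sigma']
  refine Finset.prod_bij (fun c hc => ⟨⟨c.1, lt_of_lt_rowLen hlam (mem_skew.1 hc).2⟩, c.2 + 1⟩)
    ?_ ?_ ?_ ?_
  · rintro ⟨i, j⟩ hc
    have := mem_skew.1 hc
    simp
    omega
  · rintro ⟨i, j⟩ hc ⟨i', j'⟩ hc' h
    simp at h
    simp [h]
  · rintro ⟨i, c⟩ hc
    simp at hc
    refine ⟨(i.val, (c - 1).toNat), mem_skew.2 (by omega), ?_⟩
    have : ((c - 1).toNat : ℤ) + 1 = c := by omega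
    simp only [this, Fin.eta]
  · rintro ⟨i, j⟩ hc
    exact rppWeight_eq_row hT ⟨i, lt_of_lt_rowLen hlam (mem_skew.1 hc).2⟩ j hc

/-- Columns are shifted by one, from `j` to `c = j + 1`. Since `1 ≤ r i`, positivity of the entries
follows from the flags. -/
theorem gRow_eq_genFun (hlam : lam.colLen 0 ≤ n) (hmu : mu.colLen 0 ≤ n) (r s : Fin n → ℕ)
    (hr : ∀ i, 1 ≤ r i) :
    gRow lam mu r s = rowWeights.genFun (fun i : Fin n => (lam.rowLen i : ℤ))
      (fun i => (mu.rowLen i : ℤ)) (fun i => (r i : ℤ)) (fun i => (s i : ℤ)) := by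
  refine (finsum_mrpp (fun E => ∀ (i : Fin n) (j : ℕ), (i.val, j) ∈ skew lam mu →
    r i ≤ E i j ∧ E i j ≤ s i) (rowMRPP_finite lam mu r s hlam)).trans ?_
  let f : (ℕ → ℕ → ℕ) → Fin n → ℤ → ℤ := fun E i c => if 1 ≤ c then E i (c - 1).toNat else 0
  let g : (Fin n → ℤ → ℤ) → ℕ → ℕ → ℕ := fun T i j =>
    if h : i < n then (T ⟨i, h⟩ (j + 1)).toNat else 0
  have hf : ∀ E (i : Fin n) (j : ℕ), f E i (j + 1) = E i j := by
    intro E i j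
    have h1 : (1 : ℤ) ≤ j + 1 := by omega
    simp [f]
  have hg : ∀ T (i : Fin n) (j : ℕ), g T i j = (T i (j + 1)).toNat := by
    intro T i j
    simp [g]
  have hcell : ∀ (i : Fin n) (c : ℤ), (mu.rowLen i : ℤ) < c → c ≤ lam.rowLen i →
      ∃ j : ℕ, c = j + 1 ∧ (i.val, j) ∈ skew lam mu := fun i c h1 h2 =>
    ⟨(c - 1).toNat, by omega, mem_skew.2 (by omega)⟩
  refine finsum_mem_eq_of_bijOn f (Set.InvOn.bijOn (f' := g) ⟨?_, ?_⟩ ?_ ?_) ?_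
  · rintro E ⟨hE, -⟩
    ext i j
    by_cases hi : i < n
    · rw [hg (f E) ⟨i, hi⟩ j, hf]
      simp
    · have : (i, j) ∉ skew lam mu := fun hc => hi (lt_of_lt_rowLen hlam (mem_skew.1 hc).2)
      simp [g, hi, hE.zeros i j this]
  · intro T hT
    have hT' : IsFilling _ _ _ _ T := hT
    ext i c
    by_cases hc : 1 ≤ c
    · obtain ⟨j, rfl⟩ : ∃ j : ℕ, c = j + 1 := ⟨(c - 1).toNat, by omega⟩
      rw [hf, hg, Int.toNat_of_nonneg]
      by_cases hcell : (mu.rowLen i : ℤ) < j + 1 ∧ (j + 1 : ℤ) ≤ lam.rowLen i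
      · have := (hT'.flag i _ hcell.1 hcell.2).1
        omega
      · rw [hT'.zero i _ hcell]
    · rw [hT'.zero i c (by omega)]
      simp [f, hc]
  · rintro E ⟨hE, hQ⟩
    refine ⟨fun i => Int.ofNat_le.2 ((youngDiagram_le_iff hmu).1 hE.subset i), fun i c hc => ?_,
      fun i c hc hc' => ?_, fun i c c' hcc' hc hc' => ?_, fun i i' c hii' hc hc' => ?_⟩
    · by_cases h1 : 1 ≤ c
      · obtain ⟨j, rfl⟩ : ∃ j : ℕ, c = j + 1 := ⟨(c - 1).toNat, by omega⟩
        rw [hf, hE.zeros i j fun h => hc (by have := mem_skew.1 h; omega)]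
        simp
      · simp [f, h1]
    · obtain ⟨j, rfl, hj⟩ := hcell i c hc hc'
      rw [hf]
      have := hQ i j hj
      omega
    · obtain ⟨j, rfl, hj⟩ := hcell i c hc (hcc'.trans hc')
      obtain ⟨j', rfl, hj'⟩ := hcell i c' (hc.trans_le hcc') hc'
      rw [hf, hf]
      exact Int.ofNat_le.2 (hE.row_weak i j j' (by omega) hj hj')
    · have h1 := lam.rowLen_anti i.val i'.val hii'
      have h2 := mu.rowLen_anti i.val i'.val hii'
      obtain ⟨j, rfl, hj⟩ := hcell i c hc (by omega)
      have hj' : (i'.val, j) ∈ skew lam mu := mem_skew.2 (by omega)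
      rw [hf, hf]
      exact Int.ofNat_le.2 (hE.col_weak i i' j hii' hj hj')
  · intro T hT
    have hT' : IsFilling _ _ _ _ T := hT
    have hpos : ∀ (i : Fin n) (j : ℕ), (i.val, j) ∈ skew lam mu →
        (r i : ℤ) ≤ T i (j + 1) ∧ T i (j + 1) ≤ s i := by
      intro i j hij
      have := mem_skew.1 hij
      exact hT'.flag i (j + 1) (by omega) (by omega)
    have hrow : ∀ i j, (i, j) ∈ skew lam mu → ∃ i' : Fin n, i'.val = i := fun i j hij =>
      ⟨⟨i, lt_of_lt_rowLen hlam (mem_skew.1 hij).2⟩, rfl⟩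
    refine ⟨⟨(youngDiagram_le_iff hmu).2 fun i => Int.ofNat_le.1 (hT'.le i), fun i j hij => ?_,
      fun i j hij => ?_, fun i j j' hjj' hj hj' => ?_, fun i i' j hii' hi hi' => ?_⟩,
      fun i j hij => ?_⟩
    · obtain ⟨i, rfl⟩ := hrow i j hij
      have h1 := hpos i j hij
      have h2 := hr i
      rw [hg]
      omega
    · by_cases hi : i < n
      · have h1 := hT'.zero ⟨i, hi⟩ (j + 1) fun h => hij (mem_skew.2 (by simp at h; omega))
        simp [g, hi, h1]
      · simp [g, hi]
    · obtain ⟨i, rfl⟩ := hrow i j hj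
      have h1 := mem_skew.1 hj
      have h2 := mem_skew.1 hj'
      rw [hg, hg]
      exact Int.toNat_le_toNat (hT'.row i _ _ (by omega) (by omega) (by omega))
    · obtain ⟨i, rfl⟩ := hrow i j hi
      obtain ⟨i', rfl⟩ := hrow i' j hi'
      have h1 := mem_skew.1 hi
      have h2 := mem_skew.1 hi'
      rw [hg, hg]
      exact Int.toNat_le_toNat (hT'.col i i' _ hii' (by omega) (by omega))
    · have := hpos i j hij
      rw [hg]
      omega
  · rintro E ⟨hE, hQ⟩
    exact prod_rppWeight_eq_row hlam fun i j _ => hf E i j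

end Row

/-! ### The column version -/

section Column

variable {lam mu : YoungDiagram} {n : ℕ}

/-- The cell `(i, j)` moves to row `j.rev` and column `-i`. Its right neighbour becomes the cell
above and its upper neighbour the cell to the right, so `-α` takes the place of `β`, and `β` that of
`-α`. -/
theorem rppWeight_eq_col {E : ℕ → ℕ → ℕ} {T : Fin n → ℤ → ℤ}
    (hT : ∀ (i : ℕ) (j : Fin n), (i, j.val) ∈ skew lam.transpose mu.transpose →
      T j.rev (-(i : ℤ)) = -(E i j : ℤ)) (hlam : lam.colLen 0 ≤ n)
    (i : ℕ) (j : Fin n) (hij : (i, j.val) ∈ skew lam.transpose mu.transpose) :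
    rppWeight lam.transpose mu.transpose E i j =
      (colWeights n).cellWeight (fun j => -(mu.rowLen j.rev : ℤ))
        (fun j => -(lam.rowLen j.rev : ℤ)) T j.rev (-(i : ℤ)) := by
  have hcell := mem_skew_transpose.1 hij
  have hrev := Fin.val_rev j
  have e1 : (∃ j' : Fin n, j'.val + 1 = j.rev.val ∧ -(lam.rowLen j'.rev : ℤ) < -(i : ℤ) ∧
      T j' (-(i : ℤ)) = T j.rev (-(i : ℤ))) ↔
      (i, j.val + 1) ∈ skew lam.transpose mu.transpose ∧ E i j = E i (j.val + 1) := by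
    constructor
    · rintro ⟨j', hj', hlt, heq⟩
      have h1 : j'.rev.val = j.val + 1 := by rw [Fin.val_rev]; omega
      have h2 := mu.rowLen_anti j.val (j.val + 1) (by omega)
      rw [h1] at hlt
      have h3 : (i, j.val + 1) ∈ skew lam.transpose mu.transpose :=
        mem_skew_transpose.2 (by omega)
      have h4 := hT i j'.rev (by rwa [h1])
      rw [Fin.rev_rev, h1] at h4
      rw [hT i j hij, h4] at heq
      exact ⟨h3, by omega⟩
    · rintro ⟨h1, h2⟩
      have hmem := mem_skew_transpose.1 h1
      have hlt := lt_of_lt_rowLen hlam hmem.2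
      have h3 := hT i ⟨j.val + 1, hlt⟩ h1
      refine ⟨Fin.rev ⟨j.val + 1, hlt⟩, ?_, ?_, ?_⟩
      · rw [Fin.val_rev, hrev]
        simp
        omega
      · rw [Fin.rev_rev]
        simp
        omega
      · rw [h3, hT i j hij, h2]
  have e2 : (-(i : ℤ) < -(mu.rowLen j.rev.rev : ℤ) ∧
      T j.rev (-(i : ℤ) + 1) = T j.rev (-(i : ℤ))) ↔
      1 ≤ i ∧ (i - 1, j.val) ∈ skew lam.transpose mu.transpose ∧ E i j = E (i - 1) j := by
    rw [Fin.rev_rev]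
    constructor
    · rintro ⟨h1, h2⟩
      have h3 : (i - 1, j.val) ∈ skew lam.transpose mu.transpose :=
        mem_skew_transpose.2 (by omega)
      have h4 := hT (i - 1) j h3
      rw [show -((i - 1 : ℕ) : ℤ) = -(i : ℤ) + 1 by omega] at h4
      rw [h4, hT i j hij] at h2
      exact ⟨by omega, h3, by omega⟩
    · rintro ⟨h1, h2, h3⟩
      have h4 := hT (i - 1) j h2
      rw [show -((i - 1 : ℕ) : ℤ) = -(i : ℤ) + 1 by omega] at h4
      have h5 := mem_skew_transpose.1 h2
      exact ⟨by omega, by rw [h4, hT i j hij, h3]⟩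
  rw [rppWeight, plainWeight, Weights.cellWeight]
  rw [hT i j hij] at e1 e2
  simp only [e1, e2, hT i j hij]
  congr 1
  · split_ifs with h
    · have h1 := lt_of_lt_rowLen hlam (mem_skew_transpose.1 h.1).2
      have h2 : j.rev.val - 1 + 1 < n := by omega
      have h3 : n - 1 - (j.rev.val - 1) = j.val + 1 := by
        rw [hrev]
        omega
      simp only [colWeights, if_pos h2, h3]
    · rfl
  · split_ifs with h
    · have h1 : 0 < i := h.1
      simp [colWeights, h1]
    · simp [colWeights]

theorem prod_rppWeight_eq_col {E : ℕ → ℕ → ℕ} {T : Fin n → ℤ → ℤ}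
    (hT : ∀ (i : ℕ) (j : Fin n), (i, j.val) ∈ skew lam.transpose mu.transpose →
      T j.rev (-(i : ℤ)) = -(E i j : ℤ)) (hlam : lam.colLen 0 ≤ n) :
    ∏ c ∈ skew lam.transpose mu.transpose, rppWeight lam.transpose mu.transpose E c.1 c.2 =
      (colWeights n).weight (fun j : Fin n => -(mu.rowLen j.rev : ℤ))
        (fun j => -(lam.rowLen j.rev : ℤ)) T := by
  rw [Weights.weight, Finset.prod_sigma']
  refine Finset.prod_bij (fun c hc =>
    ⟨Fin.rev ⟨c.2, lt_of_lt_rowLen hlam (mem_skew_transpose.1 hc).2⟩, -(c.1 : ℤ)⟩) ?_ ?_ ?_ ?_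
  · rintro ⟨i, j⟩ hc
    have := mem_skew_transpose.1 hc
    simp only [Finset.mem_sigma, Finset.mem_univ, Finset.mem_Ioc, true_and, Fin.rev_rev]
    omega
  · rintro ⟨i, j⟩ hc ⟨i', j'⟩ hc' h
    simp at h
    simp [h]
  · rintro ⟨j, c⟩ hc
    simp only [Finset.mem_sigma, Finset.mem_univ, Finset.mem_Ioc, true_and] at hc
    refine ⟨((-c).toNat, j.rev.val), mem_skew_transpose.2 (by omega), ?_⟩
    have : -((-c).toNat : ℤ) = c := by omega
    simp only [this, Fin.eta, Fin.rev_rev]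
  · rintro ⟨i, j⟩ hc
    exact rppWeight_eq_col hT hlam i ⟨j, lt_of_lt_rowLen hlam (mem_skew_transpose.1 hc).2⟩ hc

/-- Negating the entries restores weak increase after the reflection and turns the flag interval
`[r, s]` into `[-s, -r]`. -/
theorem gCol_eq_genFun (hlam : lam.colLen 0 ≤ n) (hmu : mu.colLen 0 ≤ n) (r s : Fin n → ℕ)
    (hr : ∀ i, 1 ≤ r i) :
    gCol lam.transpose mu.transpose r s =
      (colWeights n).genFun (fun j : Fin n => -(mu.rowLen j.rev : ℤ))
        (fun j => -(lam.rowLen j.rev : ℤ)) (fun j => -(s j.rev : ℤ)) (fun j => -(r j.rev : ℤ)) := by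
  have hlam' : lam.transpose.rowLen 0 ≤ n := by simpa using hlam
  refine (finsum_mrpp (fun E => ∀ (i : ℕ) (j : Fin n),
    (i, j.val) ∈ skew lam.transpose mu.transpose → r j ≤ E i j ∧ E i j ≤ s j)
    (colMRPP_finite lam.transpose mu.transpose r s hlam')).trans ?_
  let f : (ℕ → ℕ → ℕ) → Fin n → ℤ → ℤ := fun E j c => if c ≤ 0 then -E (-c).toNat j.rev else 0
  let g : (Fin n → ℤ → ℤ) → ℕ → ℕ → ℕ := fun T i j =>
    if h : j < n then (-T (Fin.rev ⟨j, h⟩) (-(i : ℤ))).toNat else 0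
  have hf : ∀ E (i : ℕ) (j : Fin n), f E j (-(i : ℤ)) = -(E i j.rev : ℤ) := by
    intro E i j
    simp [f]
  have hg : ∀ T (i : ℕ) (j : Fin n), g T i j = (-T j.rev (-(i : ℤ))).toNat := by
    intro T i j
    simp [g]
  have hcell : ∀ (j : Fin n) (c : ℤ), -(lam.rowLen j.rev : ℤ) < c → c ≤ -(mu.rowLen j.rev : ℤ) →
      ∃ i : ℕ, c = -(i : ℤ) ∧ (i, j.rev.val) ∈ skew lam.transpose mu.transpose := fun j c h1 h2 =>
    ⟨(-c).toNat, by omega, mem_skew_transpose.2 (by omega)⟩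
  have hle : mu.transpose ≤ lam.transpose ↔ ∀ j : Fin n, mu.rowLen j ≤ lam.rowLen j := by
    rw [← youngDiagram_le_iff hmu]
    exact YoungDiagram.transpose_le_iff
  refine finsum_mem_eq_of_bijOn f (Set.InvOn.bijOn (f' := g) ⟨?_, ?_⟩ ?_ ?_) ?_
  · rintro E ⟨hE, -⟩
    ext i j
    by_cases hj : j < n
    · rw [hg (f E) i ⟨j, hj⟩, hf, Fin.rev_rev]
      simp
    · have : (i, j) ∉ skew lam.transpose mu.transpose :=
        fun hc => hj (lt_of_lt_rowLen hlam (mem_skew_transpose.1 hc).2)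
      simp [g, hj, hE.zeros i j this]
  · intro T hT
    have hT' : IsFilling _ _ _ _ T := hT
    ext j c
    by_cases hc : c ≤ 0
    · obtain ⟨i, rfl⟩ : ∃ i : ℕ, c = -(i : ℤ) := ⟨(-c).toNat, by omega⟩
      rw [hf, hg, Fin.rev_rev, Int.toNat_of_nonneg, neg_neg]
      by_cases hcell : -(lam.rowLen j.rev : ℤ) < -(i : ℤ) ∧ -(i : ℤ) ≤ -(mu.rowLen j.rev : ℤ)
      · have := (hT'.flag j _ hcell.1 hcell.2).2
        omega
      · rw [hT'.zero j _ hcell, neg_zero]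
    · rw [hT'.zero j c (by omega)]
      simp [f, hc]
  · rintro E ⟨hE, hQ⟩
    refine ⟨fun j => neg_le_neg (Int.ofNat_le.2 (hle.1 hE.subset j.rev)), fun j c hc => ?_,
      fun j c hc hc' => ?_, fun j c c' hcc' hc hc' => ?_, fun j j' c hjj' hc hc' => ?_⟩
    · by_cases h1 : c ≤ 0
      · obtain ⟨i, rfl⟩ : ∃ i : ℕ, c = -(i : ℤ) := ⟨(-c).toNat, by omega⟩
        rw [hf, hE.zeros i j.rev fun h => hc (by have := mem_skew_transpose.1 h; omega)]
        simp
      · simp [f, h1]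
    · obtain ⟨i, rfl, hi⟩ := hcell j c hc hc'
      rw [hf]
      have := hQ i j.rev hi
      omega
    · obtain ⟨i, rfl, hi⟩ := hcell j c hc (hcc'.trans hc')
      obtain ⟨i', rfl, hi'⟩ := hcell j c' (hc.trans_le hcc') hc'
      rw [hf, hf]
      exact neg_le_neg (Int.ofNat_le.2 (hE.col_weak i' i j.rev (by omega) hi' hi))
    · have hrev : j'.rev.val ≤ j.rev.val := Fin.le_def.1 (Fin.rev_le_rev.2 hjj')
      have h1 := lam.rowLen_anti _ _ hrev
      have h2 := mu.rowLen_anti _ _ hrev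
      obtain ⟨i, rfl, hi⟩ := hcell j c hc (by omega)
      have hi' : (i, j'.rev.val) ∈ skew lam.transpose mu.transpose :=
        mem_skew_transpose.2 (by omega)
      rw [hf, hf]
      exact neg_le_neg (Int.ofNat_le.2 (hE.row_weak i _ _ hrev hi' hi))
  · intro T hT
    have hT' : IsFilling _ _ _ _ T := hT
    have hpos : ∀ (i : ℕ) (j : Fin n), (i, j.val) ∈ skew lam.transpose mu.transpose →
        -(s j : ℤ) ≤ T j.rev (-(i : ℤ)) ∧ T j.rev (-(i : ℤ)) ≤ -(r j : ℤ) := by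
      intro i j hij
      have := mem_skew_transpose.1 hij
      have h1 := hT'.flag j.rev (-(i : ℤ)) (by rw [Fin.rev_rev]; omega)
        (by rw [Fin.rev_rev]; omega)
      rwa [Fin.rev_rev] at h1
    have hcol : ∀ i j, (i, j) ∈ skew lam.transpose mu.transpose → ∃ j' : Fin n, j'.val = j :=
      fun i j hij => ⟨⟨j, lt_of_lt_rowLen hlam (mem_skew_transpose.1 hij).2⟩, rfl⟩
    refine ⟨⟨hle.2 fun j => ?_, fun i j hij => ?_,
      fun i j hij => ?_, fun i j j' hjj' hj hj' => ?_, fun i i' j hii' hi hi' => ?_⟩,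
      fun i j hij => ?_⟩
    · have := hT'.le j.rev
      rw [Fin.rev_rev] at this
      exact Int.ofNat_le.1 (neg_le_neg_iff.1 this)
    · obtain ⟨j, rfl⟩ := hcol i j hij
      have h1 := hpos i j hij
      have h2 := hr j
      rw [hg]
      omega
    · by_cases hj : j < n
      · have h1 := hT'.zero (Fin.rev ⟨j, hj⟩) (-(i : ℤ)) fun h =>
          hij (mem_skew_transpose.2 (by rw [Fin.rev_rev] at h; simp at h; omega))
        simp [g, hj, h1]
      · simp [g, hj]
    · obtain ⟨j, rfl⟩ := hcol i j hj
      obtain ⟨j', rfl⟩ := hcol i j' hj'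
      have h1 := mem_skew_transpose.1 hj
      have h2 := mem_skew_transpose.1 hj'
      rw [hg, hg]
      exact Int.toNat_le_toNat (neg_le_neg (hT'.col j'.rev j.rev _
        (Fin.rev_le_rev.2 (Fin.le_def.2 hjj')) (by rw [Fin.rev_rev]; omega)
        (by rw [Fin.rev_rev]; omega)))
    · obtain ⟨j, rfl⟩ := hcol i j hi
      have h1 := mem_skew_transpose.1 hi
      have h2 := mem_skew_transpose.1 hi'
      rw [hg, hg]
      exact Int.toNat_le_toNat (neg_le_neg (hT'.row j.rev _ _ (by omega)
        (by rw [Fin.rev_rev]; omega) (by rw [Fin.rev_rev]; omega)))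
    · have := hpos i j hij
      rw [hg]
      omega
  · rintro E ⟨hE, hQ⟩
    refine prod_rppWeight_eq_col (fun i j _ => ?_) hlam
    rw [hf, Fin.rev_rev]

end Column

end FlaggedFilling

theorem theorem4p2 (n : ℕ) (lam mu : YoungDiagram)
    (hlam : lam.colLen 0 ≤ n) (hmu : mu.colLen 0 ≤ n)
    (r s : Fin n → ℕ) (hr : ∀ i, 1 ≤ r i) (hs : ∀ i, 1 ≤ s i)
    (hflag : ∀ (i : ℕ) (hi : i + 1 < n), mu.rowLen i < lam.rowLen (i + 1) →
      r ⟨i, Nat.lt_of_succ_lt hi⟩ ≤ r ⟨i + 1, hi⟩ ∧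
      s ⟨i, Nat.lt_of_succ_lt hi⟩ ≤ s ⟨i + 1, hi⟩) :
    gRow lam mu r s =
      Matrix.det (Matrix.of fun i j : Fin n =>
        h ((lam.rowLen i : ℤ) - mu.rowLen j - i + j)
          (Xint (r j) (s i) - A (lam.rowLen i - 1) + A (mu.rowLen j)
            + B i - B j)) ∧
    gCol lam.transpose mu.transpose r s =
      Matrix.det (Matrix.of fun i j : Fin n =>
        e ((lam.rowLen i : ℤ) - mu.rowLen j - i + j)
          (Xint (r j) (s i) - A i + A j
            + B (lam.rowLen i - 1) - B (mu.rowLen j))) := by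
  have hflag' : ∀ i j : Fin n, i.val + 1 = j.val → mu.rowLen i < lam.rowLen j →
      r i ≤ r j ∧ s i ≤ s j := by
    rintro ⟨i, hi⟩ ⟨j, hj⟩ hij hlt
    obtain rfl : i + 1 = j := hij
    exact hflag i hj hlt
  have hanti : ∀ nu : YoungDiagram, Antitone fun i : Fin n => (nu.rowLen i : ℤ) :=
    fun nu i j hij => Int.ofNat_le.2 (nu.rowLen_anti _ _ hij)
  have hanti' : ∀ nu : YoungDiagram, Antitone fun i : Fin n => -(nu.rowLen i.rev : ℤ) :=
    fun nu i j hij => neg_le_neg (hanti nu (Fin.rev_le_rev.2 hij))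
  constructor
  · rw [FlaggedFilling.gRow_eq_genFun hlam hmu r s hr,
      FlaggedFilling.Weights.genFun_eq_jtDet _ (hanti lam) (hanti mu) _ _
      (fun i j hij hlt => Int.ofNat_le.2 (hflag' i j hij (Int.ofNat_lt.1 hlt)).1)
      (fun i j hij hlt => Int.ofNat_le.2 (hflag' i j hij (Int.ofNat_lt.1 hlt)).2),
      FlaggedFilling.Weights.jtDet]
    simp only [FlaggedFilling.rowWeights_entry]
  · have hrev : ∀ i j : Fin n, i.val + 1 = j.val → j.rev.val + 1 = i.rev.val := by
      intro i j hij
      rw [Fin.val_rev, Fin.val_rev]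
      omega
    -- The matrix of the reflected shape is the desired one reflected in its antidiagonal;
    -- transposing and reversing both indices preserves the determinant.
    rw [FlaggedFilling.gCol_eq_genFun hlam hmu r s hr,
      FlaggedFilling.Weights.genFun_eq_jtDet _ (hanti' mu) (hanti' lam) _ _
      (fun i j hij hlt => neg_le_neg (Int.ofNat_le.2 (hflag' _ _ (hrev i j hij)
        (Int.ofNat_lt.1 (neg_lt_neg_iff.1 hlt))).2))
      (fun i j hij hlt => neg_le_neg (Int.ofNat_le.2 (hflag' _ _ (hrev i j hij)
        (Int.ofNat_lt.1 (neg_lt_neg_iff.1 hlt))).1)), FlaggedFilling.Weights.jtDet,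
      ← Matrix.det_transpose,
      ← Matrix.det_submatrix_equiv_self Fin.revPerm]
    congr 1
    refine Matrix.ext fun i j => ?_
    simp only [Matrix.submatrix_apply, Matrix.transpose_apply, Matrix.of_apply, Fin.revPerm_apply,
      Fin.rev_rev]
    rw [FlaggedFilling.colWeights_entry]
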